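/- Let $N\ge 1$ be an integer and $-1<\gamma<1$. Put $\sigma(z)=-\frac{1-\gamma}{2}$ for $z>0$ and $\sigma(z)=-\frac{1+\gamma}{2}$ for $z\le 0$. For every $\alpha>0$ the Cauchy problem $$f''+\frac{N-1}{\eta}f'=\sigma(\alpha f+\eta f')\,(\alpha f+\eta f')\quad(\eta>0),\qquad f(0)=1,\quad f'(0)=0,$$ has exactly one classical solution $f(\cdot\,;\alpha)\in C^1([0,\infty))\cap C^2((0,\infty))$; it is the profile of the self-similar solution $u(x,t)=t^{-\alpha/2}f(\|x\|/\sqrt t;\alpha)$ of $u_t+\gamma|u_t|=\Delta u$ in $\mathbb{R}^N\times(0,\infty)$. There is a sequence of similarity exponents $0<\alpha_0<\alpha_1<\alpha_2<\cdots$ with $\alpha_k\to\infty$, characterized by the following: for every $k\ge 0$ there is a constant $D\neq 0$ with $f(\eta;\alpha_k)\big/\bigl(\eta^{\alpha_k-N}e^{-\frac{1+(-1)^k\gamma}{4}\eta^2}\bigr)\to D$ as $\eta\to\infty$, and for every $\alpha>0$ not in the sequence there is a constant $C\ne 0$ with $\eta^{\alpha}f(\eta;\alpha)\to C$ as $\eta\to\infty$.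 For these exponents the following holds. 1. If $k\ge 0$ and $\alpha_k<\alpha\le\alpha_{k+1}$, then $f(\cdot\,;\alpha)$ has exactly $k+1$ zeros in $[0,\infty)$. 2. If $0<\alpha\le\alpha_0$, then $f(\eta;\alpha)>0$ for all $\eta\ge 0$. -/

import Mathlib

open Filter Topology Set

noncomputable section

namespace Barenblatt

/-- The piecewise constant coefficient of the equation for the profiles. -/
def sigma (γ z : ℝ) : ℝ := if 0 < z then -(1 - γ) / 2 else -(1 + γ) / 2

/-- `f`, restricted to `[0, ∞)`, is a classical solution of the Cauchy problem
`f'' + (N - 1) / η * f' = σ (α f + η f') (α f + η f')` for `η > 0`, `f 0 = 1`, `f' 0 = 0`.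
Here `g` is the derivative of `f` (one-sided at `0`). It is continuous up to `0`, and the last
clause is the differential equation solved for `f'' = g'`. Since `z ↦ σ z * z` is continuous,
`f` is automatically of class `C ^ 2` on `(0, ∞)`. The values of `f` on `(-∞, 0)` play no role. -/
def IsProfile (N : ℕ) (γ α : ℝ) (f : ℝ → ℝ) : Prop :=
  ∃ g : ℝ → ℝ,
    (∀ η, 0 ≤ η → HasDerivWithinAt f (g η) (Ici 0) η) ∧
    ContinuousOn g (Ici 0) ∧
    f 0 = 1 ∧ g 0 = 0 ∧
    ∀ η, 0 < η →
      HasDerivAt g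
        (sigma γ (α * f η + η * g η) * (α * f η + η * g η) - ((N : ℝ) - 1) / η * g η) η

/-- `f ∼ φ` at infinity, up to a nonzero constant factor. -/
def AsympTo (f φ : ℝ → ℝ) : Prop :=
  ∃ C : ℝ, C ≠ 0 ∧ Tendsto (fun η => f η / φ η) atTop (𝓝 C)

/-- `a 0 < a 1 < a 2 < ...` is the sequence of similarity exponents: it is positive, strictly
increasing and unbounded, the profile at `a k` has the Gaussian decay
`η ^ (a k - N) * exp (-(1 + (-1) ^ k * γ) / 4 * η ^ 2)`, and the profile at every other
positive `α` decays like `η ^ (-α)`. -/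
def IsExponentSeq (N : ℕ) (γ : ℝ) (a : ℕ → ℝ) : Prop :=
  0 < a 0 ∧ StrictMono a ∧ Tendsto a atTop atTop ∧
  (∀ k : ℕ, ∀ f : ℝ → ℝ, IsProfile N γ (a k) f →
    AsympTo f fun η =>
      η ^ (a k - (N : ℝ)) * Real.exp (-((1 + (-1) ^ k * γ) / 4) * η ^ 2)) ∧
  (∀ α : ℝ, 0 < α → α ∉ range a → ∀ f : ℝ → ℝ, IsProfile N γ α f →
    AsympTo f fun η => η ^ (-α))

end Barenblatt

end

/-!
Write `f` for the profile with exponent `α` and follow the planar curve `(f, v)`, `v = η * f'`, by its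
angle `θ`, normalized by `θ = 0` at `η = 0`. Because the nonlinearity `Phi γ` is positively homogeneous,
`θ` solves a scalar differential equation. The zeros of `f` are the times at which `θ` meets one of the
levels `π / 2 - k * π`, `k ≥ 1`, and each level is crossed at most once, downwards. Hence `f` has at least
`k + 1` zeros if and only if `θ` passes below `level (k + 1)`; the exponents with this property form the
set `crossing θ k`.

The angle is strictly decreasing in `α` (`IsPolar.angle_lt`) and continuous in `α`, so `crossing θ k` is an
open half-line. It is nonempty because the profiles oscillate rapidly for large `α`
(`IsPolar.crossing_nonempty`), and its left end point `threshold θ k` is positive because the constant `1` is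
the profile with exponent `0`. The exponents `α` with exactly `k + 1` zeros are therefore those with
`threshold θ k < α ≤ threshold θ (k + 1)`, and it remains to identify the thresholds with the exponents of
fast decay.

After its last zero, the slope `q = v / f` solves a Riccati equation whose parameter is `(-1) ^ k * γ` by the
sign of `f`. For late times it cannot drop below `-α - 2` once it is above. So either `q ≥ -α - 2` from some
time on, and then `q = -α + O(η ^ (-2))` (`riccati_slow`), or `q ≤ -α - 2` forever, and then
`q = -(1 + (-1) ^ k * γ) / 2 * η ^ 2 + α - N + O(η ^ (-2))` (`riccati_fast`). Integrating the logarithmic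
derivative `q / η` of `f` gives slow or fast decay with a nonzero constant. Slow decay is stable under
small changes of `α`, so the profiles at the thresholds decay fast. Conversely, if the profile decays fast
after `k` zeros, every larger exponent gives a further zero (`IsPolar.mem_crossing_of_fast`), by
comparison of the two expansions of `q` with the monotonicity in `α`; hence the exponent is `threshold θ k`.
The late-time barrier also shows that a small increase of `α` produces at most one further zero, so the
thresholds are strictly increasing.

The profiles themselves are obtained as fixed points of an integral operator that contracts a norm with
Gaussian weight, and an energy estimate gives their uniqueness and continuity in `α`.
-/

open Filter Topology Set

noncomputable section

namespace Barenblatt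

/-- The nonlinearity `z ↦ sigma γ z * z` of the equation, as a positively homogeneous, Lipschitz and
(for `|γ| < 1`) strictly decreasing function. -/
def Phi (γ z : ℝ) : ℝ := (-z + γ * |z|) / 2

lemma sigma_mul_self (γ z : ℝ) : sigma γ z * z = Phi γ z := by
  unfold sigma Phi
  split_ifs with h
  · rw [abs_of_pos h]; ring
  · rw [abs_of_nonpos (not_lt.mp h)]; ring

lemma continuous_Phi (γ : ℝ) : Continuous (Phi γ) := by
  unfold Phi; fun_prop

lemma abs_Phi_sub_le {γ : ℝ} (hγ : |γ| ≤ 1) (x y : ℝ) : |Phi γ x - Phi γ y| ≤ |x - y| := by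
  have h1 : |γ * (|x| - |y|)| ≤ |x - y| := by
    rw [abs_mul]
    calc |γ| * |(|x| - |y|)| ≤ 1 * |x - y| :=
          mul_le_mul hγ (abs_abs_sub_abs_le x y) (abs_nonneg _) zero_le_one
      _ = |x - y| := one_mul _
  have h2 : Phi γ x - Phi γ y = (-(x - y) + γ * (|x| - |y|)) / 2 := by unfold Phi; ring
  rw [h2, abs_div, abs_two, div_le_iff₀ two_pos]
  calc |(-(x - y) + γ * (|x| - |y|))| ≤ |(-(x - y))| + |γ * (|x| - |y|)| := abs_add_le _ _
    _ ≤ |x - y| * 2 := by rw [abs_neg]; linarith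

@[simp] lemma Phi_zero (γ : ℝ) : Phi γ 0 = 0 := by simp [Phi]

lemma abs_Phi_le {γ : ℝ} (hγ : |γ| ≤ 1) (x : ℝ) : |Phi γ x| ≤ |x| := by
  simpa using abs_Phi_sub_le hγ x 0

lemma Phi_strictAnti {γ : ℝ} (hγ : |γ| < 1) : StrictAnti (Phi γ) := by
  intro x y hxy
  have h1 : γ * (|y| - |x|) ≤ |γ| * (y - x) := by
    calc γ * (|y| - |x|) ≤ |γ * (|y| - |x|)| := le_abs_self _
      _ = |γ| * |(|y| - |x|)| := abs_mul _ _
      _ ≤ |γ| * |y - x| :=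
          mul_le_mul_of_nonneg_left (abs_abs_sub_abs_le y x) (abs_nonneg _)
      _ = |γ| * (y - x) := by rw [abs_of_pos (sub_pos.mpr hxy)]
  have h2 : |γ| * (y - x) < y - x := by nlinarith
  unfold Phi
  linarith

lemma Phi_of_nonpos (γ : ℝ) {z : ℝ} (hz : z ≤ 0) : Phi γ z = -((1 + γ) / 2) * z := by
  unfold Phi; rw [abs_of_nonpos hz]; ring

lemma Phi_of_nonneg (γ : ℝ) {z : ℝ} (hz : 0 ≤ z) : Phi γ z = -((1 - γ) / 2) * z := by
  unfold Phi; rw [abs_of_nonneg hz]; ring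

/-- `(f, g)` solves the Cauchy problem for the profiles on `[0, ∞)`, `g` being the derivative of `f`.
No derivative is required at `0`, so that every `IsProfile` yields an instance. -/
structure IsSolution (N : ℕ) (γ α : ℝ) (f g : ℝ → ℝ) : Prop where
  continuousOn_f : ContinuousOn f (Ici 0)
  continuousOn_g : ContinuousOn g (Ici 0)
  f_zero : f 0 = 1
  g_zero : g 0 = 0
  hasDerivAt_f : ∀ t, 0 < t → HasDerivAt f (g t) t
  hasDerivAt_g : ∀ t, 0 < t →
    HasDerivAt g (Phi γ (α * f t + t * g t) - ((N : ℝ) - 1) / t * g t) t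

lemma IsProfile.exists_isSolution {N : ℕ} {γ α : ℝ} {f : ℝ → ℝ} (h : IsProfile N γ α f) :
    ∃ g, IsSolution N γ α f g := by
  obtain ⟨g, h1, h2, h3, h4, h5⟩ := h
  refine ⟨g, fun t ht => (h1 t ht).continuousWithinAt, h2, h3, h4, fun t ht =>
    (h1 t ht.le).hasDerivAt (Ici_mem_nhds ht), fun t ht => ?_⟩
  simpa only [sigma_mul_self] using h5 t ht

/-! ### Existence of the profiles -/

/-- The solution operator `ψ ↦ t ^ (-n) * ∫ s in 0..t, s ^ n * ψ s` of the linear radial problem, with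
the substitution `s = t * r` which makes it regular at `t = 0`, in norms weighted by
`exp (l * t ^ 2)`. -/
lemma abs_average_le (n : ℕ) {l A M : ℝ} {ψ : ℝ → ℝ}
    (hb : ∀ s, |ψ s| ≤ A + l * M * (|s| * Real.exp (l * s ^ 2))) (t : ℝ) :
    |t * ∫ r in (0 : ℝ)..1, r ^ n * ψ (t * r)| ≤
      A * |t| + M * (Real.exp (l * t ^ 2) - 1) / 2 := by
  have hint : ∫ r in (0 : ℝ)..1, |t| * (A + l * M * (|t| * r * Real.exp (l * (t * r) ^ 2))) =
      A * |t| + M * (Real.exp (l * t ^ 2) - 1) / 2 := by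
    have hd : ∀ r ∈ uIcc (0 : ℝ) 1, HasDerivAt
        (fun r => A * |t| * r + M * Real.exp (l * (t * r) ^ 2) / 2)
        (|t| * (A + l * M * (|t| * r * Real.exp (l * (t * r) ^ 2)))) r := by
      intro r _
      have h1 : HasDerivAt (fun r => l * (t * r) ^ 2) (l * (2 * (t * r) * t)) r := by
        have := (((hasDerivAt_id r).const_mul t).pow 2).const_mul l
        simpa using this
      have h2 := ((hasDerivAt_id r).const_mul (A * |t|)).add
        ((h1.exp.const_mul M).div_const 2)
      refine h2.congr_deriv ?_
      have h3 : |t| * |t| = t * t := abs_mul_abs_self t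
      linear_combination (-(l * M * r * Real.exp (l * (t * r) ^ 2))) * h3
    rw [intervalIntegral.integral_eq_sub_of_hasDerivAt hd]
    · simp; ring
    · apply Continuous.intervalIntegrable; fun_prop
  rw [← intervalIntegral.integral_const_mul, ← hint, ← Real.norm_eq_abs]
  apply intervalIntegral.norm_integral_le_of_norm_le zero_le_one
  · refine Filter.Eventually.of_forall fun r hr => ?_
    rw [Real.norm_eq_abs, abs_mul, abs_mul]
    have h1 : |r ^ n| ≤ 1 := by
      rw [abs_pow, abs_of_pos hr.1]; exact pow_le_one₀ hr.1.le hr.2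
    have h2 := hb (t * r)
    rw [abs_mul t r, abs_of_pos hr.1] at h2
    calc |t| * (|r ^ n| * |ψ (t * r)|) ≤ |t| * (1 * |ψ (t * r)|) := by gcongr
      _ ≤ _ := by rw [one_mul]; gcongr
  · apply Continuous.intervalIntegrable; fun_prop

section Picard

open BoundedContinuousFunction

variable (γ α : ℝ) (n : ℕ)

/-- The derivative of the candidate solution encoded by the bounded function `h`. The Gaussian weight
makes the integral operator below a contraction on the whole line at once. -/
def picardG (h : ℝ →ᵇ ℝ) (s : ℝ) : ℝ := Real.exp ((|α| + 1) * s ^ 2) * h s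

/-- The candidate solution encoded by `h`. -/
def picardF (h : ℝ →ᵇ ℝ) (t : ℝ) : ℝ := 1 + ∫ s in (0 : ℝ)..t, picardG α h s

/-- The right-hand side of the equation along the candidate solution encoded by `h`. -/
def picardRhs (h : ℝ →ᵇ ℝ) (s : ℝ) : ℝ := Phi γ (α * picardF α h s + s * picardG α h s)

lemma continuous_picardG (h : ℝ →ᵇ ℝ) : Continuous (picardG α h) := by
  have := h.continuous
  unfold picardG; fun_prop

lemma hasDerivAt_picardF (h : ℝ →ᵇ ℝ) (t : ℝ) :
    HasDerivAt (picardF α h) (picardG α h t) t :=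
  ((continuous_picardG α h).integral_hasStrictDerivAt 0 t).hasDerivAt.const_add 1

lemma continuous_picardF (h : ℝ →ᵇ ℝ) : Continuous (picardF α h) :=
  continuous_iff_continuousAt.mpr fun t => (hasDerivAt_picardF α h t).continuousAt

lemma continuous_picardRhs (h : ℝ →ᵇ ℝ) : Continuous (picardRhs γ α h) := by
  have h1 := continuous_picardG α h
  have h2 := continuous_picardF α h
  have h3 := continuous_Phi γ
  unfold picardRhs
  fun_prop

lemma abs_integral_weight_le (u : ℝ → ℝ) {l M : ℝ} (hl : 0 ≤ l) (hM : 0 ≤ M)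
    (hu : ∀ s, |u s| ≤ M * Real.exp (l * s ^ 2)) (t : ℝ) :
    |∫ s in (0 : ℝ)..t, u s| ≤ M * (|t| * Real.exp (l * t ^ 2)) := by
  have h := intervalIntegral.norm_integral_le_of_norm_le_const (a := 0) (b := t) (f := u)
    (C := M * Real.exp (l * t ^ 2)) (fun s hs => by
      refine (hu s).trans ?_
      have : |s| ≤ |t| := by
        have := abs_sub_left_of_mem_uIcc (uIoc_subset_uIcc hs)
        simpa using this
      have : s ^ 2 ≤ t ^ 2 := sq_le_sq.mpr this
      gcongr)
  rw [Real.norm_eq_abs, sub_zero] at h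
  linarith

lemma abs_picardRhs_sub_le (hγ : |γ| ≤ 1) (h₁ h₂ : ℝ →ᵇ ℝ) (s : ℝ) :
    |picardRhs γ α h₁ s - picardRhs γ α h₂ s| ≤
      0 + (|α| + 1) * dist h₁ h₂ * (|s| * Real.exp ((|α| + 1) * s ^ 2)) := by
  have hg : ∀ s, |picardG α h₁ s - picardG α h₂ s| ≤
      dist h₁ h₂ * Real.exp ((|α| + 1) * s ^ 2) := by
    intro s
    unfold picardG
    rw [← mul_sub, abs_mul, abs_of_pos (Real.exp_pos _), mul_comm]
    have h0 : |h₁ s - h₂ s| ≤ dist h₁ h₂ :=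
      BoundedContinuousFunction.dist_coe_le_dist (f := h₁) (g := h₂) s
    exact mul_le_mul_of_nonneg_right h0 (Real.exp_pos _).le
  have hf : |picardF α h₁ s - picardF α h₂ s| ≤
      dist h₁ h₂ * (|s| * Real.exp ((|α| + 1) * s ^ 2)) := by
    have := abs_integral_weight_le (fun s => picardG α h₁ s - picardG α h₂ s)
      (by positivity) (dist_nonneg (x := h₁) (y := h₂)) hg s
    rw [intervalIntegral.integral_sub] at this
    · unfold picardF
      rwa [add_sub_add_left_eq_sub]
    · exact (continuous_picardG α h₁).intervalIntegrable _ _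
    · exact (continuous_picardG α h₂).intervalIntegrable _ _
  refine (abs_Phi_sub_le hγ _ _).trans ?_
  have e : α * picardF α h₁ s + s * picardG α h₁ s - (α * picardF α h₂ s + s * picardG α h₂ s)
      = α * (picardF α h₁ s - picardF α h₂ s) + s * (picardG α h₁ s - picardG α h₂ s) := by ring
  rw [e]
  refine (abs_add_le _ _).trans ?_
  rw [abs_mul, abs_mul]
  have h1 := mul_le_mul_of_nonneg_left hf (abs_nonneg α)
  have h2 := mul_le_mul_of_nonneg_left (hg s) (abs_nonneg s)
  linarith

lemma abs_picardRhs_le (hγ : |γ| ≤ 1) (h : ℝ →ᵇ ℝ) (s : ℝ) :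
    |picardRhs γ α h s| ≤
      |α| + (|α| + 1) * ‖h‖ * (|s| * Real.exp ((|α| + 1) * s ^ 2)) := by
  have h1 := abs_picardRhs_sub_le γ α hγ h 0 s
  have h2 : picardRhs γ α 0 s = Phi γ α := by simp [picardRhs, picardF, picardG]
  rw [h2, dist_zero_right] at h1
  have h3 := abs_Phi_le hγ α
  have h4 := abs_add_le (picardRhs γ α h s - Phi γ α) (Phi γ α)
  rw [sub_add_cancel] at h4
  linarith

/-- The integral operator whose fixed points encode the solutions of the equation in dimension
`n + 1`. -/
def picardFun (h : ℝ →ᵇ ℝ) (t : ℝ) : ℝ :=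
  Real.exp (-((|α| + 1) * t ^ 2)) * (t * ∫ r in (0 : ℝ)..1, r ^ n * picardRhs γ α h (t * r))

lemma continuous_picardFun (h : ℝ →ᵇ ℝ) : Continuous (picardFun γ α n h) := by
  have h1 := continuous_picardRhs γ α h
  have h2 : Continuous fun t : ℝ => ∫ r in (0 : ℝ)..1, r ^ n * picardRhs γ α h (t * r) := by
    apply intervalIntegral.continuous_parametric_intervalIntegral_of_continuous'
    unfold Function.uncurry
    fun_prop
  unfold picardFun
  fun_prop

lemma abs_picardFun_le (hγ : |γ| ≤ 1) (h : ℝ →ᵇ ℝ) (t : ℝ) :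
    |picardFun γ α n h t| ≤ |α| + ‖h‖ := by
  have h1 := abs_average_le n (abs_picardRhs_le γ α hγ h) t
  unfold picardFun
  rw [abs_mul, abs_of_pos (Real.exp_pos _), Real.exp_neg, inv_mul_le_iff₀ (Real.exp_pos _)]
  have h2 : |t| ≤ Real.exp ((|α| + 1) * t ^ 2) := by
    have h3 := Real.add_one_le_exp ((|α| + 1) * t ^ 2)
    have h4 := sq_abs t
    nlinarith [sq_nonneg (|t| - 1), abs_nonneg α, sq_nonneg t, mul_nonneg (abs_nonneg α) (sq_nonneg t)]
  have h5 := mul_le_mul_of_nonneg_left h2 (abs_nonneg α)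
  have h6 := mul_nonneg (norm_nonneg h) (Real.exp_pos ((|α| + 1) * t ^ 2)).le
  nlinarith [norm_nonneg h]

/-- `picardFun` as a self-map of the bounded continuous functions. -/
def picardMap (hγ : |γ| ≤ 1) (h : ℝ →ᵇ ℝ) : ℝ →ᵇ ℝ :=
  BoundedContinuousFunction.ofNormedAddCommGroup (picardFun γ α n h)
    (continuous_picardFun γ α n h) (|α| + ‖h‖) (abs_picardFun_le γ α n hγ h)

lemma contractingWith_picardMap (hγ : |γ| ≤ 1) :
    ContractingWith (1 / 2) (picardMap γ α n hγ) := by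
  refine ⟨by norm_num, LipschitzWith.of_dist_le_mul fun h₁ h₂ => ?_⟩
  rw [BoundedContinuousFunction.dist_le (by positivity)]
  intro t
  have hc1 := continuous_picardRhs γ α h₁
  have hc2 := continuous_picardRhs γ α h₂
  have h1 := abs_average_le n (A := 0) (abs_picardRhs_sub_le γ α hγ h₁ h₂) t
  change |picardFun γ α n h₁ t - picardFun γ α n h₂ t| ≤ _
  have e : picardFun γ α n h₁ t - picardFun γ α n h₂ t = Real.exp (-((|α| + 1) * t ^ 2)) *
      (t * ∫ r in (0 : ℝ)..1, r ^ n *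
        (picardRhs γ α h₁ (t * r) - picardRhs γ α h₂ (t * r))) := by
    unfold picardFun
    simp_rw [mul_sub]
    rw [intervalIntegral.integral_sub]
    · ring
    · apply Continuous.intervalIntegrable; fun_prop
    · apply Continuous.intervalIntegrable; fun_prop
  rw [e, abs_mul, abs_of_pos (Real.exp_pos _), Real.exp_neg, inv_mul_le_iff₀ (Real.exp_pos _)]
  refine h1.trans ?_
  have := dist_nonneg (x := h₁) (y := h₂)
  push_cast
  nlinarith

end Picard

/-- The solution is a fixed point of `picardMap`; it extends to the whole line as a `C ^ 1` function. -/
theorem exists_isSolution {N : ℕ} (hN : 1 ≤ N) {γ : ℝ} (hγ : |γ| ≤ 1) (α : ℝ) :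
    ∃ f g : ℝ → ℝ, IsSolution N γ α f g ∧ (∀ t, HasDerivAt f (g t) t) ∧ Continuous g := by
  obtain ⟨n, rfl⟩ : ∃ n, N = n + 1 := ⟨N - 1, by omega⟩
  have hfix := (contractingWith_picardMap γ α n hγ).fixedPoint_isFixedPt
  set h := ContractingWith.fixedPoint _ (contractingWith_picardMap γ α n hγ)
  have hcR := continuous_picardRhs γ α h
  have hg : ∀ t, picardG α h t = t * ∫ r in (0 : ℝ)..1, r ^ n * picardRhs γ α h (t * r) := by
    intro t
    have h1 : picardFun γ α n h t = h t := congrArg (fun u => u t) hfix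
    unfold picardG
    rw [← h1, picardFun, ← mul_assoc, ← Real.exp_add]
    simp
  have hg' : ∀ t, t ^ n * picardG α h t = ∫ s in (0 : ℝ)..t, s ^ n * picardRhs γ α h s := by
    intro t
    have h1 := intervalIntegral.mul_integral_comp_mul_left (a := 0) (b := 1)
      (f := fun s => s ^ n * picardRhs γ α h s) (c := t)
    simp only [mul_zero, mul_one] at h1
    rw [← h1, hg, mul_left_comm, ← intervalIntegral.integral_const_mul]
    congr 2
    ext r
    ring
  have hd : ∀ t, HasDerivAt (picardF α h) (picardG α h t) t := hasDerivAt_picardF α h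
  refine ⟨picardF α h, picardG α h, ⟨(continuous_picardF α h).continuousOn,
    (continuous_picardG α h).continuousOn, by simp [picardF], by simp [hg 0],
    fun t _ => hd t, fun t ht => ?_⟩, hd, continuous_picardG α h⟩
  have h1 : HasDerivAt (fun t => ∫ s in (0 : ℝ)..t, s ^ n * picardRhs γ α h s)
      (t ^ n * picardRhs γ α h t) t :=
    ((by fun_prop : Continuous fun s => s ^ n * picardRhs γ α h s).integral_hasStrictDerivAt
      0 t).hasDerivAt
  have h2 := h1.div (hasDerivAt_pow n t) (pow_ne_zero n ht.ne')
  have h3 : picardG α h =ᶠ[𝓝 t]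
      (fun t => (∫ s in (0 : ℝ)..t, s ^ n * picardRhs γ α h s) / t ^ n) := by
    filter_upwards [lt_mem_nhds ht] with s hs
    rw [← hg', mul_div_cancel_left₀ _ (pow_ne_zero n hs.ne')]
  refine (h2.congr_of_eventuallyEq h3).congr_deriv ?_
  rw [← hg' t]
  have htn : t ^ n ≠ 0 := pow_ne_zero n ht.ne'
  change _ = picardRhs γ α h t - _
  push_cast
  rcases n with _ | n
  · simp
  · rw [Nat.add_sub_cancel]
    field_simp
    push_cast
    ring

/-! ### Uniqueness and continuous dependence on the exponent -/

/-- A function that starts at or below `0` and decreases strictly wherever it vanishes is negative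
later on. -/
lemma neg_of_barrier {y y' : ℝ → ℝ} {a b : ℝ} (hab : a < b)
    (hy : ∀ t ∈ Icc a b, HasDerivAt y (y' t) t) (ha : y a ≤ 0)
    (h0 : ∀ t ∈ Icc a b, y t = 0 → y' t < 0) : y b < 0 := by
  have hle : ∀ t ∈ Icc a b, y t ≤ 0 := fun t ht =>
    image_le_of_deriv_right_lt_deriv_boundary (f := y) (f' := y') (B := fun _ => 0)
      (B' := fun _ => 0) (fun t ht => (hy t ht).continuousAt.continuousWithinAt)
      (fun t ht => (hy t (Ico_subset_Icc_self ht)).hasDerivWithinAt) ha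
      (fun t => hasDerivAt_const t 0)
      (fun t ht => h0 t (Ico_subset_Icc_self ht)) ht
  have hb : b ∈ Icc a b := right_mem_Icc.mpr hab.le
  rcases (hle b hb).lt_or_eq with h | h
  · exact h
  exfalso
  have h1 := (hasDerivAt_iff_tendsto_slope_left_right.mp (hy b hb)).1
  have h2 : ∀ᶠ t in 𝓝[<] b, slope y b t < 0 := h1.eventually_lt_const (h0 b hb h)
  have h3 : ∀ᶠ t in 𝓝[<] b, t ∈ Ioo a b := Ioo_mem_nhdsLT hab
  obtain ⟨t, ht1, ht2⟩ := (h2.and h3).exists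
  have h4 := hle t (Ioo_subset_Icc_self ht2)
  rw [slope_def_field, h, sub_zero] at ht1
  exact absurd ht1 (not_lt.mpr (div_nonneg_of_nonpos h4 (sub_nonpos.mpr ht2.2.le)))

namespace IsSolution

variable {N : ℕ} {γ α β : ℝ} {f g f₁ g₁ f₂ g₂ : ℝ → ℝ}

/-- Continuous dependence on the exponent, and uniqueness when `α = β`. This is Gronwall's argument for
`(f₁ - f₂) ^ 2 + (g₁ - g₂) ^ 2`; the singular term `-(N - 1) / t * g` enters with a favourable
sign. -/
lemma abs_sub_le (hN : 1 ≤ N) (hγ : |γ| ≤ 1)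
    (h₁ : IsSolution N γ α f₁ g₁) (h₂ : IsSolution N γ β f₂ g₂) {T M B : ℝ}
    (hM : ∀ t ∈ Icc 0 T, |f₂ t| ≤ M) (hB : |α| ≤ B) {t : ℝ} (ht : t ∈ Icc 0 T) :
    |f₁ t - f₂ t| ≤ |α - β| * M * Real.exp ((2 + B + 2 * T) * T) ∧
    |g₁ t - g₂ t| ≤ |α - β| * M * Real.exp ((2 + B + 2 * T) * T) := by
  have hT : 0 ≤ T := ht.1.trans ht.2
  have hB0 : 0 ≤ B := (abs_nonneg α).trans hB
  have hM0 : 0 ≤ M := (abs_nonneg _).trans (hM 0 ⟨le_rfl, hT⟩)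
  have hN' : (1 : ℝ) ≤ N := by exact_mod_cast hN
  set C := 2 + B + 2 * T with hC
  have hC0 : 0 ≤ C := by positivity
  set δ := |α - β| * M with hδ
  have hδ0 : 0 ≤ δ := by positivity
  set E : ℝ → ℝ := fun t => (f₁ t - f₂ t) ^ 2 + (g₁ t - g₂ t) ^ 2 with hE
  have hanti : AntitoneOn (fun t => Real.exp (-(C * t)) * (E t + δ ^ 2)) (Icc 0 T) := by
    have hs : Icc 0 T ⊆ Ici (0 : ℝ) := Icc_subset_Ici_self
    have c1 := h₁.continuousOn_f.mono hs
    have c2 := h₂.continuousOn_f.mono hs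
    have c3 := h₁.continuousOn_g.mono hs
    have c4 := h₂.continuousOn_g.mono hs
    have hd : ∀ t ∈ Ioo 0 T, HasDerivAt (fun t => Real.exp (-(C * t)) * (E t + δ ^ 2))
        (Real.exp (-(C * t)) * (-C) * (E t + δ ^ 2) + Real.exp (-(C * t)) *
          (2 * (f₁ t - f₂ t) * (g₁ t - g₂ t) + 2 * (g₁ t - g₂ t) *
          ((Phi γ (α * f₁ t + t * g₁ t) - ((N : ℝ) - 1) / t * g₁ t) -
            (Phi γ (β * f₂ t + t * g₂ t) - ((N : ℝ) - 1) / t * g₂ t)))) t := by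
      intro t ht
      have e1 : HasDerivAt (fun t => Real.exp (-(C * t))) (Real.exp (-(C * t)) * (-C)) t := by
        have := ((hasDerivAt_id t).const_mul C).neg.exp
        simpa using this
      have e2 := ((h₁.hasDerivAt_f t ht.1).sub (h₂.hasDerivAt_f t ht.1)).pow 2
      have e3 := ((h₁.hasDerivAt_g t ht.1).sub (h₂.hasDerivAt_g t ht.1)).pow 2
      have e4 := e1.mul ((e2.add e3).add_const (δ ^ 2))
      refine e4.congr_deriv ?_
      simp [hE]
    apply antitoneOn_of_deriv_nonpos (convex_Icc 0 T)
    · have : Continuous fun t : ℝ => Real.exp (-(C * t)) := by fun_prop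
      exact this.continuousOn.mul ((((c1.sub c2).pow 2).add ((c3.sub c4).pow 2)).add
        continuousOn_const)
    · rw [interior_Icc]
      exact fun t ht => (hd t ht).differentiableAt.differentiableWithinAt
    · rw [interior_Icc]
      intro t ht
      rw [(hd t ht).deriv]
      set x := f₁ t - f₂ t with hx
      set y := g₁ t - g₂ t with hy
      have hΦ := abs_Phi_sub_le hγ (α * f₁ t + t * g₁ t) (β * f₂ t + t * g₂ t)
      set P := Phi γ (α * f₁ t + t * g₁ t) - Phi γ (β * f₂ t + t * g₂ t) with hP
      have hw : |P| ≤ B * |x| + T * |y| + δ := by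
        refine hΦ.trans ?_
        have e : α * f₁ t + t * g₁ t - (β * f₂ t + t * g₂ t) =
          α * x + t * y + (α - β) * f₂ t := by rw [hx, hy]; ring
        rw [e]
        refine (abs_add_three _ _ _).trans ?_
        rw [abs_mul, abs_mul, abs_mul, abs_of_pos ht.1]
        have e2 := mul_le_mul_of_nonneg_left (hM t ⟨ht.1.le, ht.2.le⟩) (abs_nonneg (α - β))
        have e3 := ht.2.le
        gcongr
      have hsing : 0 ≤ ((N : ℝ) - 1) / t * y ^ 2 :=
        mul_nonneg (div_nonneg (by linarith) ht.1.le) (sq_nonneg _)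
      have hyP : y * P ≤ |y| * (B * |x| + T * |y| + δ) := by
        calc y * P ≤ |y * P| := le_abs_self _
          _ = |y| * |P| := abs_mul _ _
          _ ≤ _ := by gcongr
      have hxy : x * y ≤ |x| * |y| := by rw [← abs_mul]; exact le_abs_self _
      have e5 : E t = |x| ^ 2 + |y| ^ 2 := by rw [sq_abs, sq_abs]
      have e6 : ((Phi γ (α * f₁ t + t * g₁ t) - ((N : ℝ) - 1) / t * g₁ t) -
            (Phi γ (β * f₂ t + t * g₂ t) - ((N : ℝ) - 1) / t * g₂ t)) =
            P - ((N : ℝ) - 1) / t * y := by rw [hP, hy]; ring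
      rw [e6, e5]
      have h7 : 2 * (|x| * |y|) ≤ |x| ^ 2 + |y| ^ 2 := by nlinarith [sq_nonneg (|x| - |y|)]
      have h8 : 2 * (|y| * δ) ≤ |y| ^ 2 + δ ^ 2 := by nlinarith [sq_nonneg (|y| - δ)]
      have h9 : B * (2 * (|x| * |y|)) ≤ B * (|x| ^ 2 + |y| ^ 2) := by gcongr
      have h10 : 0 ≤ T * |x| ^ 2 := by positivity
      have h11 : 0 ≤ B * δ ^ 2 := by positivity
      have h12 : 0 ≤ T * δ ^ 2 := by positivity
      have key : 2 * x * y + 2 * y * (P - ((N : ℝ) - 1) / t * y) ≤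
          C * (|x| ^ 2 + |y| ^ 2 + δ ^ 2) := by
        rw [hC]
        nlinarith [sq_nonneg δ, sq_nonneg (|x|)]
      have := mul_le_mul_of_nonneg_left key (Real.exp_pos (-(C * t))).le
      linarith
  have h0 := hanti ⟨le_rfl, hT⟩ ht ht.1
  have hE0 : E 0 = 0 := by simp [hE, h₁.f_zero, h₂.f_zero, h₁.g_zero, h₂.g_zero]
  simp only [hE0, mul_zero, neg_zero, Real.exp_zero, one_mul, zero_add] at h0
  rw [Real.exp_neg, inv_mul_le_iff₀ (Real.exp_pos _)] at h0
  have hexp : Real.exp (C * t) ≤ Real.exp (C * T) ^ 2 := by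
    rw [← Real.exp_nat_mul]
    apply Real.exp_le_exp.mpr
    have := mul_le_mul_of_nonneg_left ht.2 hC0
    have := mul_nonneg hC0 hT
    push_cast
    linarith
  have h1 : E t ≤ (δ * Real.exp (C * T)) ^ 2 := by
    rw [mul_pow]
    have := mul_le_mul_of_nonneg_right hexp (sq_nonneg δ)
    nlinarith [sq_nonneg δ]
  have hpos : 0 ≤ δ * Real.exp (C * T) := by positivity
  constructor
  · apply abs_le_of_sq_le_sq _ hpos
    have := sq_nonneg (g₁ t - g₂ t)
    simp only [hE] at h1
    linarith
  · apply abs_le_of_sq_le_sq _ hpos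
    have := sq_nonneg (f₁ t - f₂ t)
    simp only [hE] at h1
    linarith

lemma exists_bound (h : IsSolution N γ α f g) (T : ℝ) : ∃ M, ∀ t ∈ Icc 0 T, |f t| ≤ M := by
  obtain ⟨M, hM⟩ := isCompact_Icc.exists_bound_of_continuousOn
    (h.continuousOn_f.mono fun s hs => hs.1)
  exact ⟨M, hM⟩

lemma eq_of_nonneg (hN : 1 ≤ N) (hγ : |γ| ≤ 1) (h₁ : IsSolution N γ α f₁ g₁)
    (h₂ : IsSolution N γ α f₂ g₂) {t : ℝ} (ht : 0 ≤ t) : f₁ t = f₂ t ∧ g₁ t = g₂ t := by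
  obtain ⟨M, hM⟩ := h₂.exists_bound t
  have := abs_sub_le hN hγ h₁ h₂ hM le_rfl ⟨ht, le_rfl⟩
  simp only [sub_self, abs_zero, zero_mul] at this
  exact ⟨sub_eq_zero.mp (abs_eq_zero.mp (le_antisymm this.1 (abs_nonneg _))),
    sub_eq_zero.mp (abs_eq_zero.mp (le_antisymm this.2 (abs_nonneg _)))⟩

/-- A solution and its derivative never vanish together, by Gronwall's argument on `[ε, t]`, away from
the singular point `0`. -/
lemma sq_add_sq_pos (hN : 1 ≤ N) (hγ : |γ| ≤ 1) (h : IsSolution N γ α f g) {t : ℝ}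
    (ht : 0 ≤ t) : 0 < f t ^ 2 + g t ^ 2 := by
  rcases ht.eq_or_lt with rfl | ht
  · simp [h.f_zero, h.g_zero]
  have hN' : (1 : ℝ) ≤ N := by exact_mod_cast hN
  have h0 : ∀ᶠ s in 𝓝[>] (0 : ℝ), 0 < f s := by
    have := (h.continuousOn_f 0 self_mem_Ici).mono_left (nhdsWithin_mono 0 Ioi_subset_Ici_self)
    exact this.eventually_const_lt (by rw [h.f_zero]; exact one_pos)
  obtain ⟨ε, hε, hεt⟩ := (h0.and (Ioo_mem_nhdsGT ht)).exists
  set C := 1 + |α| + 2 * t + 2 * (((N : ℝ) - 1) / ε) with hC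
  have hd : ∀ s ∈ Icc ε t, HasDerivAt (fun s => Real.exp (C * s) * (f s ^ 2 + g s ^ 2))
      (Real.exp (C * s) * C * (f s ^ 2 + g s ^ 2) + Real.exp (C * s) *
        (2 * f s * g s + 2 * g s *
          (Phi γ (α * f s + s * g s) - ((N : ℝ) - 1) / s * g s))) s := by
    intro s hs
    have hs0 : 0 < s := hεt.1.trans_le hs.1
    have e1 : HasDerivAt (fun t => Real.exp (C * t)) (Real.exp (C * s) * C) s := by
      have := ((hasDerivAt_id s).const_mul C).exp
      simpa using this
    have e4 := e1.mul (((h.hasDerivAt_f s hs0).pow 2).add ((h.hasDerivAt_g s hs0).pow 2))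
    refine e4.congr_deriv ?_
    simp
  have hmono : MonotoneOn (fun s => Real.exp (C * s) * (f s ^ 2 + g s ^ 2)) (Icc ε t) := by
    apply monotoneOn_of_deriv_nonneg (convex_Icc ε t)
    · exact fun s hs => (hd s hs).continuousAt.continuousWithinAt
    · rw [interior_Icc]
      exact fun s hs => (hd s (Ioo_subset_Icc_self hs)).differentiableAt.differentiableWithinAt
    · rw [interior_Icc]
      intro s hs
      rw [(hd s (Ioo_subset_Icc_self hs)).deriv]
      have hs0 : 0 < s := hεt.1.trans hs.1
      set P := Phi γ (α * f s + s * g s) with hP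
      have hw : |P| ≤ |α| * |f s| + t * |g s| := by
        refine (abs_Phi_le hγ _).trans ((abs_add_le _ _).trans ?_)
        rw [abs_mul, abs_mul, abs_of_pos hs0]
        have := hs.2.le
        gcongr
      have hsing : ((N : ℝ) - 1) / s * g s ^ 2 ≤ ((N : ℝ) - 1) / ε * g s ^ 2 := by
        apply mul_le_mul_of_nonneg_right _ (sq_nonneg _)
        exact div_le_div_of_nonneg_left (by linarith) hεt.1 hs.1.le
      have hK : 0 ≤ ((N : ℝ) - 1) / ε := div_nonneg (by linarith) hεt.1.le
      have hyP : -(g s * P) ≤ |g s| * (|α| * |f s| + t * |g s|) := by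
        calc -(g s * P) ≤ |g s * P| := neg_le_abs _
          _ = |g s| * |P| := abs_mul _ _
          _ ≤ _ := by gcongr
      have hxy : -(f s * g s) ≤ |f s| * |g s| := by rw [← abs_mul]; exact neg_le_abs _
      have e5 : f s ^ 2 + g s ^ 2 = |f s| ^ 2 + |g s| ^ 2 := by rw [sq_abs, sq_abs]
      have h7 : 2 * (|f s| * |g s|) ≤ |f s| ^ 2 + |g s| ^ 2 := by
        nlinarith [sq_nonneg (|f s| - |g s|)]
      have h9 : |α| * (2 * (|f s| * |g s|)) ≤ |α| * (|f s| ^ 2 + |g s| ^ 2) := by gcongr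
      have h10 : 0 ≤ t * |f s| ^ 2 := by positivity
      have h11 : 0 ≤ ((N : ℝ) - 1) / ε * |f s| ^ 2 := by positivity
      have e12 : g s ^ 2 = |g s| ^ 2 := (sq_abs _).symm
      have key : 0 ≤ C * (f s ^ 2 + g s ^ 2) + (2 * f s * g s + 2 * g s *
          (P - ((N : ℝ) - 1) / s * g s)) := by
        rw [hC, e5]
        have : g s * (((N : ℝ) - 1) / s * g s) = ((N : ℝ) - 1) / s * g s ^ 2 := by ring
        rw [e12] at hsing this
        linarith
      have := mul_nonneg (Real.exp_pos (C * s)).le key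
      linarith
  have h1 := hmono ⟨le_rfl, hεt.2.le⟩ ⟨hεt.2.le, le_rfl⟩ hεt.2.le
  have h2 : 0 < Real.exp (C * ε) * (f ε ^ 2 + g ε ^ 2) :=
    mul_pos (Real.exp_pos _) (add_pos_of_pos_of_nonneg (pow_pos hε 2) (sq_nonneg _))
  exact pos_of_mul_pos_right (h2.trans_le h1) (Real.exp_pos _).le

end IsSolution

/-- Joint continuity in the exponent and the variable; `max p.2 0` extends the solutions, which matter
on `[0, ∞)` only, to the whole line. -/
lemma continuous_family {N : ℕ} {γ : ℝ} {F G : ℝ → ℝ → ℝ} (hN : 1 ≤ N) (hγ : |γ| ≤ 1)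
    (h : ∀ α, IsSolution N γ α (F α) (G α)) :
    Continuous (fun p : ℝ × ℝ => F p.1 (max p.2 0)) ∧
    Continuous (fun p : ℝ × ℝ => G p.1 (max p.2 0)) := by
  have key : ∀ p₀ : ℝ × ℝ, ∃ K, ∀ᶠ p : ℝ × ℝ in 𝓝 p₀,
      |F p.1 (max p.2 0) - F p₀.1 (max p.2 0)| ≤ |p.1 - p₀.1| * K ∧
      |G p.1 (max p.2 0) - G p₀.1 (max p.2 0)| ≤ |p.1 - p₀.1| * K := by
    intro p₀
    obtain ⟨M, hM⟩ := (h p₀.1).exists_bound (|p₀.2| + 1)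
    refine ⟨M * Real.exp ((2 + (|p₀.1| + 1) + 2 * (|p₀.2| + 1)) * (|p₀.2| + 1)), ?_⟩
    have e1 : ∀ᶠ p : ℝ × ℝ in 𝓝 p₀, |p.1| < |p₀.1| + 1 :=
      continuous_fst.abs.continuousAt.eventually_lt_const (lt_add_one _)
    have e2 : ∀ᶠ p : ℝ × ℝ in 𝓝 p₀, |p.2| < |p₀.2| + 1 :=
      continuous_snd.abs.continuousAt.eventually_lt_const (lt_add_one _)
    filter_upwards [e1, e2] with p hp1 hp2
    have := IsSolution.abs_sub_le hN hγ (h p.1) (h p₀.1) hM hp1.le (t := max p.2 0)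
      ⟨le_max_right _ _, max_le ((le_abs_self _).trans hp2.le) (by positivity)⟩
    rwa [mul_assoc] at this
  have hlim : ∀ (p₀ : ℝ × ℝ) (K : ℝ),
      Tendsto (fun p : ℝ × ℝ => |p.1 - p₀.1| * K) (𝓝 p₀) (𝓝 0) := by
    intro p₀ K
    have : Continuous fun p : ℝ × ℝ => |p.1 - p₀.1| * K := by fun_prop
    simpa using this.tendsto p₀
  have main : ∀ U : ℝ → ℝ → ℝ, (∀ α, ContinuousOn (U α) (Ici 0)) →
      (∀ p₀ : ℝ × ℝ, ∃ K, ∀ᶠ p : ℝ × ℝ in 𝓝 p₀,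
        |U p.1 (max p.2 0) - U p₀.1 (max p.2 0)| ≤ |p.1 - p₀.1| * K) →
      Continuous (fun p : ℝ × ℝ => U p.1 (max p.2 0)) := by
    intro U hU hK
    refine continuous_iff_continuousAt.mpr fun p₀ => ?_
    obtain ⟨K, hK⟩ := hK p₀
    have h1 : Tendsto (fun p : ℝ × ℝ => U p.1 (max p.2 0) - U p₀.1 (max p.2 0)) (𝓝 p₀) (𝓝 0) :=
      squeeze_zero_norm' hK (hlim p₀ K)
    have h2 : Continuous fun p : ℝ × ℝ => U p₀.1 (max p.2 0) :=
      (hU p₀.1).comp_continuous (by fun_prop) (fun p => mem_Ici.mpr (le_max_right _ _))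
    have h3 := h1.add (h2.tendsto p₀)
    simpa [ContinuousAt] using h3
  exact ⟨main F (fun α => (h α).continuousOn_f) fun p₀ =>
      (key p₀).imp fun K hK => hK.mono fun p hp => hp.1,
    main G (fun α => (h α).continuousOn_g) fun p₀ =>
      (key p₀).imp fun K hK => hK.mono fun p hp => hp.2⟩

/-! ### The phase angle -/

lemma Phi_mul {γ a : ℝ} (ha : 0 ≤ a) (z : ℝ) : Phi γ (a * z) = a * Phi γ z := by
  unfold Phi; rw [abs_mul, abs_of_nonneg ha]; ring

/-- The right-hand side of the equation `θ' = angleField N γ α t θ` for the angle of the planar curve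
`t ↦ (f t, t * f' t)`; it is independent of the radius because `Phi γ` is positively homogeneous. -/
def angleField (N : ℕ) (γ α t x : ℝ) : ℝ :=
  (2 - (N : ℝ)) / t * (Real.sin x * Real.cos x) +
    t * (Real.cos x * Phi γ (α * Real.cos x + Real.sin x)) - Real.sin x ^ 2 / t

/-- `F α` is the profile with exponent `α`, `G α` its derivative, and `θ α`, `ρ α` are the continuous
polar coordinates of the curve `t ↦ (F α t, t * G α t)`, `t ≥ 0`, with `θ α 0 = 0`. All real
exponents are allowed, which makes `α = 0` an interior point of the parameter range. -/
structure IsPolar (N : ℕ) (γ : ℝ) (F G θ ρ : ℝ → ℝ → ℝ) : Prop where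
  one_le : 1 ≤ N
  abs_lt_one : |γ| < 1
  isSolution : ∀ α, IsSolution N γ α (F α) (G α)
  continuous_param : ∀ t, Continuous fun α => θ α t
  continuous : ∀ α, Continuous (θ α)
  angle_zero : ∀ α, θ α 0 = 0
  hasDerivAt : ∀ α t, 0 < t → HasDerivAt (θ α) (angleField N γ α t (θ α t)) t
  radius_pos : ∀ α t, 0 ≤ t → 0 < ρ α t
  F_eq : ∀ α t, 0 ≤ t → F α t = ρ α t * Real.cos (θ α t)
  G_eq : ∀ α t, 0 ≤ t → t * G α t = ρ α t * Real.sin (θ α t)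

theorem exists_isPolar {N : ℕ} (hN : 1 ≤ N) {γ : ℝ} (hγ : |γ| < 1) :
    ∃ F G θ ρ, IsPolar N γ F G θ ρ := by
  choose F G hsol _ _ using fun α => exists_isSolution hN hγ.le α
  obtain ⟨hcF, hcG⟩ := continuous_family hN hγ.le hsol
  have hden : ∀ α t, 0 ≤ t → 0 < F α t ^ 2 + (t * G α t) ^ 2 := by
    intro α t ht
    rcases ht.eq_or_lt with rfl | ht'
    · simp [(hsol α).f_zero]
    · by_contra hcon
      have h1 := (hsol α).sq_add_sq_pos hN hγ.le ht
      have h2 : F α t ^ 2 = 0 := by nlinarith [sq_nonneg (F α t), sq_nonneg (t * G α t)]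
      have h3 : (t * G α t) ^ 2 = 0 := by nlinarith [sq_nonneg (F α t), sq_nonneg (t * G α t)]
      rw [mul_pow] at h3
      have h4 : G α t ^ 2 = 0 := by
        rcases mul_eq_zero.mp h3 with h | h
        · exact absurd h (pow_pos ht' 2).ne'
        · exact h
      linarith
  -- the angular velocity of the planar curve `(f, t f')`
  set K : ℝ → ℝ → ℝ := fun α t =>
    (F α t * ((2 - (N : ℝ)) * G α t + t * Phi γ (α * F α t + t * G α t)) -
      G α t * (t * G α t)) / (F α t ^ 2 + (t * G α t) ^ 2) with hK
  have hcK : Continuous (fun p : ℝ × ℝ => K p.1 (max p.2 0)) := by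
    have hΦ := continuous_Phi γ
    have key : ∀ A B : ℝ × ℝ → ℝ, Continuous A → Continuous B →
        (∀ p, 0 < A p ^ 2 + (max p.2 0 * B p) ^ 2) → Continuous fun p : ℝ × ℝ =>
        (A p * ((2 - (N : ℝ)) * B p + max p.2 0 * Phi γ (p.1 * A p + max p.2 0 * B p)) -
          B p * (max p.2 0 * B p)) / (A p ^ 2 + (max p.2 0 * B p) ^ 2) := by
      intro A B hA hB hpos
      exact Continuous.div (by fun_prop) (by fun_prop) fun p => (hpos p).ne'
    exact key _ _ hcF hcG fun p => hden p.1 _ (le_max_right _ _)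
  have hcK1 : ∀ α, Continuous fun t => K α (max t 0) := fun α =>
    hcK.comp (by fun_prop : Continuous fun t : ℝ => (α, t))
  set θ : ℝ → ℝ → ℝ := fun α t => ∫ s in (0 : ℝ)..t, K α (max s 0) with hθ
  have hθd : ∀ α t, HasDerivAt (θ α) (K α (max t 0)) t := fun α t =>
    ((hcK1 α).integral_hasStrictDerivAt 0 t).hasDerivAt
  have hθc : ∀ α, Continuous (θ α) := fun α =>
    continuous_iff_continuousAt.mpr fun t => (hθd α t).continuousAt
  have hθ0 : ∀ α, θ α 0 = 0 := fun α => by simp [hθ]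
  set ρ : ℝ → ℝ → ℝ := fun α t =>
    F α t * Real.cos (θ α t) + t * G α t * Real.sin (θ α t) with hρ
  set b : ℝ → ℝ → ℝ := fun α t =>
    t * G α t * Real.cos (θ α t) - F α t * Real.sin (θ α t) with hb
  have hsq : ∀ α t, ρ α t ^ 2 + b α t ^ 2 = F α t ^ 2 + (t * G α t) ^ 2 := by
    intro α t
    have := Real.sin_sq_add_cos_sq (θ α t)
    simp only [hρ, hb]
    linear_combination (F α t ^ 2 + (t * G α t) ^ 2) * this
  have hcρ : ∀ α, ContinuousOn (ρ α) (Ici 0) := by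
    intro α
    have h1 := (hsol α).continuousOn_f
    have h2 := (hsol α).continuousOn_g
    have h3 := (hθc α).continuousOn (s := Ici 0)
    simp only [hρ]
    fun_prop
  have hcb : ∀ α, ContinuousOn (b α) (Ici 0) := by
    intro α
    have h1 := (hsol α).continuousOn_f
    have h2 := (hsol α).continuousOn_g
    have h3 := (hθc α).continuousOn (s := Ici 0)
    simp only [hb]
    fun_prop
  have hvd : ∀ α t, 0 < t → HasDerivAt (fun t => t * G α t)
      ((2 - (N : ℝ)) * G α t + t * Phi γ (α * F α t + t * G α t)) t := by
    intro α t ht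
    refine ((hasDerivAt_id t).mul ((hsol α).hasDerivAt_g t ht)).congr_deriv ?_
    simp only [id]
    field_simp
    ring
  -- the component of the curve orthogonal to the direction `θ` vanishes identically
  have hb0 : ∀ α t, 0 ≤ t → b α t = 0 := by
    intro α t ht
    have hanti : AntitoneOn (fun t => b α t ^ 2 / (F α t ^ 2 + (t * G α t) ^ 2)) (Icc 0 t) := by
      have hd : ∀ s ∈ Ioo 0 t,
          HasDerivAt (fun t => b α t ^ 2 / (F α t ^ 2 + (t * G α t) ^ 2)) 0 s := by
        intro s hs
        have d1 := (hsol α).hasDerivAt_f s hs.1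
        have d2 := hvd α s hs.1
        have d3 := hθd α s
        rw [max_eq_left hs.1.le] at d3
        have d4 := (((d2.mul d3.cos).sub (d1.mul d3.sin)).pow 2).div
          ((d1.pow 2).add (d2.pow 2)) (hden α s hs.1.le).ne'
        refine d4.congr_deriv ?_
        have hE := (hden α s hs.1.le).ne'
        have hKE : K α s * (F α s ^ 2 + (s * G α s) ^ 2) =
            F α s * ((2 - (N : ℝ)) * G α s + s * Phi γ (α * F α s + s * G α s)) -
            G α s * (s * G α s) := by
          simp only [hK]; exact div_mul_cancel₀ _ hE
        have hcs := Real.sin_sq_add_cos_sq (θ α s)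
        simp only [Pi.pow_apply, Pi.add_apply, Pi.sub_apply, Pi.mul_apply]
        rw [div_eq_zero_iff]
        left
        generalize (2 - (N : ℝ)) * G α s + s * Phi γ (α * F α s + s * G α s) = V' at hKE ⊢
        generalize s * G α s = v at hKE ⊢
        generalize F α s = f at hKE ⊢
        generalize G α s = g at hKE ⊢
        generalize K α s = k at hKE ⊢
        generalize Real.cos (θ α s) = c at hcs ⊢
        generalize Real.sin (θ α s) = σ at hcs ⊢
        push_cast
        linear_combination (-2 * (v * c - f * σ) * (v * σ + f * c)) * hKE
      apply antitoneOn_of_deriv_nonpos (convex_Icc 0 t)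
      · have h1 := (hcb α).mono (fun s hs => hs.1 : Icc 0 t ⊆ Ici 0)
        have h2 := (hsol α).continuousOn_f.mono (fun s hs => hs.1 : Icc 0 t ⊆ Ici 0)
        have h3 := (hsol α).continuousOn_g.mono (fun s hs => hs.1 : Icc 0 t ⊆ Ici 0)
        apply ContinuousOn.div
        · fun_prop
        · fun_prop
        · exact fun s hs => (hden α s hs.1).ne'
      · rw [interior_Icc]
        exact fun s hs => (hd s hs).differentiableAt.differentiableWithinAt
      · rw [interior_Icc]
        exact fun s hs => (hd s hs).deriv.le
    have h1 := hanti ⟨le_rfl, ht⟩ ⟨ht, le_rfl⟩ ht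
    have h2 : b α 0 = 0 := by simp [hb, hθ0]
    simp only [h2] at h1
    rw [zero_pow two_ne_zero, zero_div, div_le_iff₀ (hden α t ht), zero_mul] at h1
    exact pow_eq_zero_iff two_ne_zero |>.mp (le_antisymm h1 (sq_nonneg _))
  have hρ2 : ∀ α t, 0 ≤ t → ρ α t ^ 2 = F α t ^ 2 + (t * G α t) ^ 2 := by
    intro α t ht
    rw [← hsq, hb0 α t ht]; ring
  have hρpos : ∀ α t, 0 ≤ t → 0 < ρ α t := by
    intro α t ht
    by_contra hneg
    have h0 : ρ α 0 = 1 := by simp [hρ, hθ0, (hsol α).f_zero]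
    have h1 : (0 : ℝ) ∈ Icc (ρ α t) (ρ α 0) := ⟨not_lt.mp hneg, by rw [h0]; exact zero_le_one⟩
    obtain ⟨s, hs, hs0⟩ := intermediate_value_Icc' ht
      ((hcρ α).mono Icc_subset_Ici_self) h1
    have h2 := hρ2 α s hs.1
    rw [hs0] at h2
    have := hden α s hs.1
    linarith
  have hF : ∀ α t, 0 ≤ t → F α t = ρ α t * Real.cos (θ α t) := by
    intro α t ht
    have h1 := hb0 α t ht
    have h2 := Real.sin_sq_add_cos_sq (θ α t)
    simp only [hb] at h1
    simp only [hρ]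
    linear_combination (-(F α t)) * h2 + (-Real.sin (θ α t)) * h1
  have hG : ∀ α t, 0 ≤ t → t * G α t = ρ α t * Real.sin (θ α t) := by
    intro α t ht
    have h1 := hb0 α t ht
    have h2 := Real.sin_sq_add_cos_sq (θ α t)
    simp only [hb] at h1
    simp only [hρ]
    linear_combination (-(t * G α t)) * h2 + (Real.cos (θ α t)) * h1
  refine ⟨F, G, θ, ρ, hN, hγ, hsol, fun t => ?_, hθc, hθ0, fun α t ht => ?_, hρpos, hF, hG⟩
  · exact intervalIntegral.continuous_parametric_intervalIntegral_of_continuous' hcK 0 t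
  · -- after division by the radius, the angular velocity is `angleField`
    refine (hθd α t).congr_deriv ?_
    rw [max_eq_left ht.le]
    have hp := hρpos α t ht.le
    have hE := hρ2 α t ht.le
    have hG' : G α t = ρ α t * Real.sin (θ α t) / t := by
      rw [← hG α t ht.le]; field_simp
    simp only [hK]
    rw [← hE, hG α t ht.le, hF α t ht.le, hG',
      show α * (ρ α t * Real.cos (θ α t)) + ρ α t * Real.sin (θ α t) =
        ρ α t * (α * Real.cos (θ α t) + Real.sin (θ α t)) by ring, Phi_mul hp.le]
    unfold angleField
    generalize ρ α t = r at hp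
    field_simp

/-! ### Monotonicity of the angle in the exponent -/

lemma angleField_antitone_param {N : ℕ} {γ : ℝ} (hγ : |γ| < 1) {α β t : ℝ} (h : α ≤ β)
    (ht : 0 < t) (x : ℝ) : angleField N γ β t x ≤ angleField N γ α t x := by
  have hΦ := (Phi_strictAnti hγ).antitone
  have key : Real.cos x * Phi γ (β * Real.cos x + Real.sin x) ≤
      Real.cos x * Phi γ (α * Real.cos x + Real.sin x) := by
    rcases le_total 0 (Real.cos x) with hc | hc
    · refine mul_le_mul_of_nonneg_left (hΦ ?_) hc
      have := mul_le_mul_of_nonneg_right h hc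
      linarith
    · refine mul_le_mul_of_nonpos_left (hΦ ?_) hc
      have := mul_le_mul_of_nonpos_right h hc
      linarith
  unfold angleField
  have := mul_le_mul_of_nonneg_left key ht.le
  linarith

/-- A Lipschitz bound in the angle, away from the singular time `0`. -/
lemma angleField_sub_le (N : ℕ) {γ : ℝ} (hγ : |γ| ≤ 1) (β : ℝ) {a b t : ℝ} (ha : 0 < a)
    (ht : t ∈ Icc a b) (x y : ℝ) :
    angleField N γ β t x - angleField N γ β t y ≤
      ((2 * |2 - (N : ℝ)| + 2) / a + b * (2 * (|β| + 1))) * |x - y| := by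
  have ht0 : 0 < t := ha.trans_le ht.1
  have hs := Real.abs_sin_sub_sin_le x y
  have hc := Real.abs_cos_sub_cos_le x y
  have hs1 := Real.abs_sin_le_one x
  have hs2 := Real.abs_sin_le_one y
  have hc1 := Real.abs_cos_le_one x
  have hc2 := Real.abs_cos_le_one y
  have hd := abs_nonneg (x - y)
  set d := |x - y|
  set s₁ := Real.sin x
  set s₂ := Real.sin y
  set c₁ := Real.cos x
  set c₂ := Real.cos y
  set p₁ := Phi γ (β * c₁ + s₁)
  set p₂ := Phi γ (β * c₂ + s₂)
  have h1 : |s₁ * c₁ - s₂ * c₂| ≤ 2 * d := by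
    rw [show s₁ * c₁ - s₂ * c₂ = (s₁ - s₂) * c₁ + s₂ * (c₁ - c₂) by ring]
    refine (abs_add_le _ _).trans ?_
    rw [abs_mul, abs_mul]
    nlinarith [mul_le_mul hs hc1 (abs_nonneg _) hd, mul_le_mul hs2 hc (abs_nonneg _) zero_le_one]
  have h2 : |s₁ ^ 2 - s₂ ^ 2| ≤ 2 * d := by
    rw [show s₁ ^ 2 - s₂ ^ 2 = (s₁ - s₂) * s₁ + s₂ * (s₁ - s₂) by ring]
    refine (abs_add_le _ _).trans ?_
    rw [abs_mul, abs_mul]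
    nlinarith [mul_le_mul hs hs1 (abs_nonneg _) hd, mul_le_mul hs2 hs (abs_nonneg _) zero_le_one]
  have h3 : |p₁| ≤ |β| + 1 := by
    refine (abs_Phi_le hγ _).trans ((abs_add_le _ _).trans ?_)
    rw [abs_mul]
    have := mul_le_mul_of_nonneg_left hc1 (abs_nonneg β)
    linarith
  have h4 : |p₁ - p₂| ≤ (|β| + 1) * d := by
    refine (abs_Phi_sub_le hγ _ _).trans ?_
    rw [show β * c₁ + s₁ - (β * c₂ + s₂) = β * (c₁ - c₂) + (s₁ - s₂) by ring]
    refine (abs_add_le _ _).trans ?_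
    rw [abs_mul]
    have := mul_le_mul_of_nonneg_left hc (abs_nonneg β)
    linarith
  have h5 : |c₁ * p₁ - c₂ * p₂| ≤ 2 * (|β| + 1) * d := by
    rw [show c₁ * p₁ - c₂ * p₂ = (c₁ - c₂) * p₁ + c₂ * (p₁ - p₂) by ring]
    refine (abs_add_le _ _).trans ?_
    rw [abs_mul, abs_mul]
    have e1 := mul_le_mul hc h3 (abs_nonneg _) hd
    have e2 := mul_le_mul hc2 h4 (abs_nonneg _) zero_le_one
    linarith
  have e : angleField N γ β t x - angleField N γ β t y =
      ((2 - (N : ℝ)) * (s₁ * c₁ - s₂ * c₂)) / t + t * (c₁ * p₁ - c₂ * p₂)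
        - (s₁ ^ 2 - s₂ ^ 2) / t := by
    simp only [angleField, s₁, s₂, c₁, c₂, p₁, p₂]; ring
  rw [e]
  have f1 : ((2 - (N : ℝ)) * (s₁ * c₁ - s₂ * c₂)) / t ≤ (2 * |2 - (N : ℝ)| * d) / a := by
    have : (2 - (N : ℝ)) * (s₁ * c₁ - s₂ * c₂) ≤ 2 * |2 - (N : ℝ)| * d := by
      refine (le_abs_self _).trans ?_
      rw [abs_mul]
      have := mul_le_mul_of_nonneg_left h1 (abs_nonneg (2 - (N : ℝ)))
      linarith
    exact (div_le_div_of_nonneg_right this ht0.le).trans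
      (div_le_div_of_nonneg_left (by positivity) ha ht.1)
  have f2 : -((s₁ ^ 2 - s₂ ^ 2) / t) ≤ (2 * d) / a := by
    rw [← neg_div]
    exact (div_le_div_of_nonneg_right ((neg_le_abs _).trans h2) ht0.le).trans
      (div_le_div_of_nonneg_left (by positivity) ha ht.1)
  have f3 : t * (c₁ * p₁ - c₂ * p₂) ≤ b * (2 * (|β| + 1) * d) := by
    have := (le_abs_self _).trans h5
    calc t * (c₁ * p₁ - c₂ * p₂) ≤ t * (2 * (|β| + 1) * d) :=
          mul_le_mul_of_nonneg_left this ht0.le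
      _ ≤ _ := mul_le_mul_of_nonneg_right ht.2 (by positivity)
  have : ((2 * |2 - (N : ℝ)| + 2) / a + b * (2 * (|β| + 1))) * d =
    (2 * |2 - (N : ℝ)| * d) / a + (2 * d) / a + b * (2 * (|β| + 1) * d) := by ring
  linarith

namespace IsPolar

variable {N : ℕ} {γ : ℝ} {F G θ ρ : ℝ → ℝ → ℝ}

/-- Near `0` the equation for the angle is singular, and the angles are compared by means of the
Wronskian instead. -/
lemma eventually_angle_lt (P : IsPolar N γ F G θ ρ) {α β : ℝ} (h : α < β) :
    ∀ᶠ t in 𝓝[>] (0 : ℝ), θ β t < θ α t := by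
  have hsα := P.isSolution α
  have hsβ := P.isSolution β
  have hΦc := continuous_Phi γ
  set ψ : ℝ → ℝ := fun t => Phi γ (α * F α t + t * G α t) * F β t -
    F α t * Phi γ (β * F β t + t * G β t) with hψ
  have hcψ : ContinuousOn ψ (Ici 0) := by
    have h1 := hsα.continuousOn_f
    have h2 := hsα.continuousOn_g
    have h3 := hsβ.continuousOn_f
    have h4 := hsβ.continuousOn_g
    have h5 : ContinuousOn (fun t => Phi γ (α * F α t + t * G α t)) (Ici 0) :=
      hΦc.comp_continuousOn (by fun_prop)
    have h6 : ContinuousOn (fun t => Phi γ (β * F β t + t * G β t)) (Ici 0) :=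
      hΦc.comp_continuousOn (by fun_prop)
    simp only [hψ]
    fun_prop
  have hψ0 : 0 < ψ 0 := by
    simp only [hψ, hsα.f_zero, hsβ.f_zero]
    have := Phi_strictAnti P.abs_lt_one h
    simp only [zero_mul, add_zero, mul_one, one_mul]
    linarith
  have hψev : ∀ᶠ t in 𝓝[>] (0 : ℝ), 0 < ψ t :=
    ((hcψ 0 self_mem_Ici).mono_left (nhdsWithin_mono 0 Ioi_subset_Ici_self)).eventually_const_lt
      hψ0
  obtain ⟨ε, hε, hψε⟩ := (mem_nhdsGT_iff_exists_Ioo_subset).mp hψev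
  -- the weighted Wronskian
  set W : ℝ → ℝ := fun t => t ^ (N - 1) * (G α t * F β t - F α t * G β t) with hW
  have hWd : ∀ t, 0 < t → HasDerivAt W (t ^ (N - 1) * ψ t) t := by
    intro t ht
    have d1 := (((hsα.hasDerivAt_g t ht).mul (hsβ.hasDerivAt_f t ht)).sub
      ((hsα.hasDerivAt_f t ht).mul (hsβ.hasDerivAt_g t ht)))
    refine ((hasDerivAt_pow (N - 1) t).mul d1).congr_deriv ?_
    obtain ⟨n, hn⟩ : ∃ n, N = n + 1 := ⟨N - 1, by have := P.one_le; omega⟩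
    simp only [hψ, Pi.sub_apply, Pi.mul_apply]
    subst hn
    rcases n with _ | n
    · simp; ring
    · simp only [Nat.add_sub_cancel]
      push_cast
      field_simp
      ring
  have hWc : ContinuousOn W (Ici 0) := by
    have h1 := hsα.continuousOn_f
    have h2 := hsα.continuousOn_g
    have h3 := hsβ.continuousOn_f
    have h4 := hsβ.continuousOn_g
    simp only [hW]
    fun_prop
  have hW0 : W 0 = 0 := by simp [hW, hsα.g_zero, hsβ.g_zero]
  have hWpos : ∀ t ∈ Ioo 0 ε, 0 < W t := by
    intro t ht
    have hm : StrictMonoOn W (Icc 0 t) := by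
      apply strictMonoOn_of_deriv_pos (convex_Icc 0 t) (hWc.mono fun s hs => hs.1)
      rw [interior_Icc]
      intro s hs
      rw [(hWd s hs.1).deriv]
      exact mul_pos (pow_pos hs.1 _) (hψε ⟨hs.1, hs.2.trans ht.2⟩)
    have := hm ⟨le_rfl, ht.1.le⟩ ⟨ht.1.le, le_rfl⟩ ht.1
    rwa [hW0] at this
  have hsmall : ∀ᶠ t in 𝓝[>] (0 : ℝ), -Real.pi < θ α t - θ β t := by
    have hc : Continuous fun t => θ α t - θ β t := (P.continuous α).sub (P.continuous β)
    refine (hc.tendsto 0).mono_left nhdsWithin_le_nhds |>.eventually_const_lt ?_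
    rw [P.angle_zero, P.angle_zero]
    linarith [Real.pi_pos]
  filter_upwards [hsmall, Ioo_mem_nhdsGT hε] with t ht1 ht
  by_contra hcon
  have h1 : Real.sin (θ α t - θ β t) ≤ 0 :=
    Real.sin_nonpos_of_nonpos_of_neg_pi_le (by linarith) ht1.le
  have h2 : 0 < t * (G α t * F β t - F α t * G β t) :=
    mul_pos ht.1 (pos_of_mul_pos_right (hWpos t ht) (pow_nonneg ht.1.le _))
  have h3 : t * (G α t * F β t - F α t * G β t) =
      ρ α t * ρ β t * Real.sin (θ α t - θ β t) := by
    rw [Real.sin_sub]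
    have e1 := P.F_eq α t ht.1.le
    have e2 := P.F_eq β t ht.1.le
    have e3 := P.G_eq α t ht.1.le
    have e4 := P.G_eq β t ht.1.le
    rw [show t * (G α t * F β t - F α t * G β t) = (t * G α t) * F β t - F α t * (t * G β t) by
      ring, e1, e2, e3, e4]
    ring
  have h4 : 0 < ρ α t * ρ β t := mul_pos (P.radius_pos α t ht.1.le) (P.radius_pos β t ht.1.le)
  rw [h3] at h2
  exact absurd h2 (not_lt.mpr (mul_nonpos_of_nonneg_of_nonpos h4.le h1))

theorem angle_lt (P : IsPolar N γ F G θ ρ) {α β : ℝ} (h : α < β) {t : ℝ} (ht : 0 < t) :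
    θ β t < θ α t := by
  -- start from a small time `a > 0`; the exponential is a barrier for the difference of the angles
  obtain ⟨a, haθ, ha⟩ := ((P.eventually_angle_lt h).and (Ioo_mem_nhdsGT ht)).exists
  set L := (2 * |2 - (N : ℝ)| + 2) / a + t * (2 * (|β| + 1)) with hL
  have hLpos : 0 < L := by have := ha.1; positivity
  set κ := θ α a - θ β a with hκ
  have hκ0 : 0 < κ := sub_pos.mpr haθ
  have hexp : ∀ s, HasDerivAt (fun s => κ * Real.exp (-(2 * L) * (s - a)))
      (κ * (Real.exp (-(2 * L) * (s - a)) * (-(2 * L)))) s := by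
    intro s
    have := (((hasDerivAt_id s).sub_const a).const_mul (-(2 * L))).exp.const_mul κ
    simpa using this
  have hb := neg_of_barrier (y := fun s => θ β s - θ α s + κ * Real.exp (-(2 * L) * (s - a)))
    (a := a) (b := t) ha.2
    (fun s hs => ((P.hasDerivAt β s (ha.1.trans_le hs.1)).sub
      (P.hasDerivAt α s (ha.1.trans_le hs.1))).add (hexp s))
    (by simp [hκ]) (by
      intro s hs h0
      have hs0 : 0 < s := ha.1.trans_le hs.1
      have hpos : 0 < κ * Real.exp (-(2 * L) * (s - a)) := by positivity
      have h1 : |θ β s - θ α s| = κ * Real.exp (-(2 * L) * (s - a)) := by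
        rw [abs_of_neg (by linarith)]; linarith
      have h2 := angleField_sub_le N P.abs_lt_one.le β ha.1 hs (θ β s) (θ α s)
      rw [h1] at h2
      have h3 := angleField_antitone_param (N := N) P.abs_lt_one h.le hs0 (θ α s)
      have h4 := mul_pos hLpos hpos
      rw [← hL] at h2
      linarith)
  have hpos : 0 < κ * Real.exp (-(2 * L) * (t - a)) := by positivity
  linarith

end IsPolar

/-! ### Levels and floors of the angle -/

/-- The directions `π / 2 - k * π` of the vertical axis, that is, the zeros of the profile. -/
def level (k : ℕ) : ℝ := Real.pi / 2 - k * Real.pi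

/-- The direction `v = -(α + 2) * f` in the sector between `level (k + 1)` and `level k`. At late times
the angle cannot pass below it. Any slope strictly below `-α` would do for this purpose; `-α - 2` leaves
room in the growth estimate of `riccati_fast`. -/
def floorAngle (α : ℝ) (k : ℕ) : ℝ := Real.arctan (-α - 2) - k * Real.pi

lemma level_succ (k : ℕ) : level (k + 1) = level k - Real.pi := by
  unfold level; push_cast; ring

lemma level_strictAnti : StrictAnti level :=
  strictAnti_nat_of_succ_lt fun k => by rw [level_succ]; linarith [Real.pi_pos]

lemma cos_level (k : ℕ) : Real.cos (level k) = 0 := by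
  unfold level; rw [Real.cos_sub_nat_mul_pi]; simp

lemma angleField_level (N : ℕ) (γ α t : ℝ) (k : ℕ) :
    angleField N γ α t (level k) = -(1 / t) := by
  have h := Real.sin_sq_add_cos_sq (level k)
  rw [cos_level] at h
  have h' : Real.sin (level k) ^ 2 = 1 := by linarith
  unfold angleField
  rw [cos_level, h']
  ring

lemma level_lt_floorAngle (α : ℝ) (k : ℕ) : level (k + 1) < floorAngle α k := by
  have := Real.neg_pi_div_two_lt_arctan (-α - 2)
  unfold level floorAngle
  push_cast
  linarith

lemma floorAngle_lt_level (α : ℝ) (k : ℕ) : floorAngle α k < level k := by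
  have := Real.arctan_lt_pi_div_two (-α - 2)
  unfold level floorAngle
  linarith

lemma Phi_neg_one_pow (γ z : ℝ) (k : ℕ) :
    Phi γ ((-1) ^ k * z) = (-1) ^ k * Phi ((-1) ^ k * γ) z := by
  unfold Phi
  rcases neg_one_pow_eq_or ℝ k with h | h
  · rw [h]; simp
  · rw [h]; simp; ring

lemma abs_neg_one_pow_mul (γ : ℝ) (k : ℕ) : |(-1) ^ k * γ| = |γ| := by
  rw [abs_mul, abs_pow, abs_neg, abs_one, one_pow, one_mul]

/-- In the sector number `k` the slope `q = tan θ` obeys a Riccati equation in which `γ` is replaced by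
`(-1) ^ k * γ`. -/
lemma angleField_eq (N : ℕ) (γ α : ℝ) {t x q c : ℝ} (k : ℕ) (hc : 0 < c)
    (hcos : Real.cos x = (-1) ^ k * c) (hsin : Real.sin x = q * Real.cos x) :
    angleField N γ α t x =
      c ^ 2 * (-(q / t) * (q + N - 2) + t * Phi ((-1) ^ k * γ) (q + α)) := by
  have h1 : α * Real.cos x + Real.sin x = (-1) ^ k * (c * (q + α)) := by rw [hsin, hcos]; ring
  have h2 : ((-1 : ℝ) ^ k) ^ 2 = 1 := by rw [← pow_mul, mul_comm, pow_mul]; simp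
  unfold angleField
  rw [h1, Phi_neg_one_pow, Phi_mul hc.le, hsin, hcos]
  linear_combination (-(q / t) * (q + N - 2) * c ^ 2 +
    t * c ^ 2 * Phi ((-1) ^ k * γ) (q + α)) * h2

/-- At late times, locally uniformly in the exponent, the floors repel upwards. -/
lemma exists_angleField_floorAngle_pos (N : ℕ) {γ : ℝ} (hγ : |γ| < 1) (B : ℝ) :
    ∃ R > 0, ∀ α, |α| ≤ B → ∀ t, R ≤ t → ∀ k, 0 < angleField N γ α t (floorAngle α k) := by
  rcases lt_or_ge B 0 with hB | hB
  · exact ⟨1, one_pos, fun α hα => absurd (abs_nonneg α) (not_le.mpr (hα.trans_lt hB))⟩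
  have hγ' : 0 < 1 - |γ| := by linarith
  refine ⟨(B + 2) * (B + N + 4) / (1 - |γ|) + 1, by positivity, fun α hα t ht k => ?_⟩
  have hR : 0 ≤ (B + 2) * (B + N + 4) / (1 - |γ|) := by positivity
  have ht1 : 1 ≤ t := by linarith
  have ht0 : 0 < t := by linarith
  have hc := Real.cos_arctan_pos (-α - 2)
  have hcos : Real.cos (floorAngle α k) = (-1) ^ k * Real.cos (Real.arctan (-α - 2)) := by
    unfold floorAngle; rw [Real.cos_sub_nat_mul_pi]
  have hsin : Real.sin (floorAngle α k) = (-α - 2) * Real.cos (floorAngle α k) := by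
    have h1 := Real.tan_arctan (-α - 2)
    rw [Real.tan_eq_sin_div_cos, div_eq_iff hc.ne'] at h1
    rw [hcos]
    unfold floorAngle
    rw [Real.sin_sub_nat_mul_pi, h1]; ring
  rw [angleField_eq N γ α k hc hcos hsin]
  apply mul_pos (pow_pos hc 2)
  rw [Phi_of_nonpos _ (by linarith)]
  set δ := (-1) ^ k * γ with hδ
  have hδγ : |δ| = |γ| := abs_neg_one_pow_mul γ k
  have hδ1 := neg_abs_le δ
  have h1 : (α + 2) * (α + 4 - N) ≤ (B + 2) * (B + N + 4) := by
    refine (le_abs_self _).trans ?_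
    rw [abs_mul]
    have e1 : |α + 2| ≤ B + 2 := by
      refine (abs_add_le _ _).trans ?_
      rw [abs_two]; linarith
    have e2 : |α + 4 - N| ≤ B + N + 4 := by
      rw [abs_le] at hα ⊢
      have : (0 : ℝ) ≤ N := Nat.cast_nonneg N
      constructor <;> linarith
    exact mul_le_mul e1 e2 (abs_nonneg _) (by linarith)
  have h2 : (B + 2) * (B + N + 4) < t * (1 - |γ|) := by
    rw [← div_lt_iff₀ hγ']; linarith
  have h3 : t * (1 - |γ|) ≤ t * t * (1 + δ) := by
    have : 1 - |γ| ≤ 1 + δ := by linarith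
    calc t * (1 - |γ|) ≤ t * t * (1 - |γ|) := by
          apply mul_le_mul_of_nonneg_right _ hγ'.le; nlinarith
      _ ≤ _ := by apply mul_le_mul_of_nonneg_left this (by positivity)
  have h4 : -((-α - 2) / t) * (-α - 2 + N - 2) + t * (-((1 + δ) / 2) * (-α - 2 + α)) =
      (t * t * (1 + δ) - (α + 2) * (α + 4 - N)) / t := by
    field_simp; ring
  rw [h4]
  exact div_pos (by linarith) ht0

namespace IsPolar

variable {N : ℕ} {γ : ℝ} {F G θ ρ : ℝ → ℝ → ℝ}

/-- The levels are crossed downwards only. -/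
lemma lt_level (P : IsPolar N γ F G θ ρ) {α s t : ℝ} {k : ℕ} (hs : 0 < s)
    (h : θ α s ≤ level k) (hst : s < t) : θ α t < level k := by
  have := neg_of_barrier (y := fun r => θ α r - level k) hst
    (fun r hr => (P.hasDerivAt α r (hs.trans_le hr.1)).sub_const (level k))
    (by linarith) (by
      intro r hr h0
      rw [show θ α r = level k by linarith, angleField_level]
      have := hs.trans_le hr.1
      simp only [Left.neg_neg_iff]
      positivity)
  linarith

lemma lt_level_zero (P : IsPolar N γ F G θ ρ) (α : ℝ) {t : ℝ} (ht : 0 ≤ t) :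
    θ α t < level 0 := by
  have h0 : θ α 0 < level 0 := by
    rw [P.angle_zero]; unfold level; simp [Real.pi_pos]
  rcases ht.eq_or_lt with rfl | ht
  · exact h0
  have h1 : ∀ᶠ s in 𝓝[>] (0 : ℝ), θ α s < level 0 :=
    (((P.continuous α).tendsto 0).mono_left nhdsWithin_le_nhds).eventually_lt_const h0
  obtain ⟨s, hs, hst⟩ := (h1.and (Ioo_mem_nhdsGT ht)).exists
  exact P.lt_level hst.1 hs.le hst.2

/-- At late times the floors are crossed upwards only. -/
lemma floorAngle_lt (P : IsPolar N γ F G θ ρ) {α R s t : ℝ} {k : ℕ} (hR : 0 < R)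
    (hpos : ∀ t, R ≤ t → 0 < angleField N γ α t (floorAngle α k))
    (hs : R ≤ s) (h : floorAngle α k ≤ θ α s) (hst : s < t) : floorAngle α k < θ α t := by
  have := neg_of_barrier (y := fun r => floorAngle α k - θ α r) hst
    (fun r hr => (P.hasDerivAt α r (hR.trans_le (hs.trans hr.1))).const_sub (floorAngle α k))
    (by linarith) (by
      intro r hr h0
      rw [show θ α r = floorAngle α k by linarith]
      linarith [hpos r (hs.trans hr.1)])
  linarith

end IsPolar

/-! ### Asymptotics of the Riccati equation -/

/-- A function that decreases at least like `-log` as long as it is nonpositive stays nonpositive and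
tends to `-∞`. -/
lemma le_neg_log_of_deriv_le {y y' : ℝ → ℝ} {a : ℝ} (ha : 0 < a)
    (hy : ∀ t, a ≤ t → HasDerivAt y (y' t) t) (h0 : y a ≤ 0)
    (h : ∀ t, a ≤ t → y t ≤ 0 → y' t ≤ -(1 / t)) {t : ℝ} (ht : a ≤ t) :
    y t ≤ -Real.log (t / a) := by
  have hneg : ∀ s, a ≤ s → y s ≤ 0 := by
    intro s hs
    rcases hs.eq_or_lt with rfl | hs
    · exact h0
    refine (neg_of_barrier hs (fun r hr => hy r hr.1) h0 fun r hr h1 => ?_).le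
    have := h r hr.1 h1.le
    have : 0 < 1 / r := one_div_pos.mpr (ha.trans_le hr.1)
    linarith
  have hd : ∀ s ∈ Icc a t, HasDerivAt (fun s => y s + Real.log s) (y' s + s⁻¹) s := fun s hs =>
    (hy s hs.1).add (Real.hasDerivAt_log (ha.trans_le hs.1).ne')
  have hanti : AntitoneOn (fun s => y s + Real.log s) (Icc a t) := by
    apply antitoneOn_of_deriv_nonpos (convex_Icc a t)
    · exact fun s hs => (hd s hs).continuousAt.continuousWithinAt
    · exact fun s hs =>
        (hd s (interior_subset hs)).differentiableAt.differentiableWithinAt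
    · intro s hs
      have hs' := interior_subset hs
      rw [(hd s hs').deriv]
      have := h s hs'.1 (hneg s hs'.1)
      rw [one_div] at this
      linarith
  have h1 := hanti ⟨le_rfl, ht⟩ ⟨ht, le_rfl⟩ ht
  simp only at h1
  rw [Real.log_div (ha.trans_le ht).ne' ha.ne']
  linarith

lemma exists_log_gt (M : ℝ) {a : ℝ} (ha : 0 < a) : ∃ t, a ≤ t ∧ M < Real.log (t / a) := by
  have h : Tendsto (fun t => Real.log (t / a)) atTop atTop :=
    Real.tendsto_log_atTop.comp (tendsto_id.atTop_div_const ha)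
  exact ((eventually_ge_atTop a).and (h.eventually_gt_atTop M)).exists

/-- A function that decreases at least like `-log` as long as it is nonnegative is eventually
nonpositive. -/
lemma eventually_nonpos_of_deriv_le {y y' : ℝ → ℝ} {a : ℝ} (ha : 0 < a)
    (hy : ∀ t, a ≤ t → HasDerivAt y (y' t) t)
    (h : ∀ t, a ≤ t → 0 ≤ y t → y' t ≤ -(1 / t)) : ∀ᶠ t in atTop, y t ≤ 0 := by
  have hex : ∃ s, a ≤ s ∧ y s ≤ 0 := by
    by_contra! hcon
    -- otherwise `y + log` is antitone on `[a, ∞)`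
    have hd : ∀ s, a ≤ s → HasDerivAt (fun s => y s + Real.log s) (y' s + s⁻¹) s := fun s hs =>
      (hy s hs).add (Real.hasDerivAt_log (ha.trans_le hs).ne')
    have hanti : AntitoneOn (fun s => y s + Real.log s) (Ici a) := by
      apply antitoneOn_of_deriv_nonpos (convex_Ici a)
      · exact fun s hs => (hd s hs).continuousAt.continuousWithinAt
      · exact fun s hs =>
          (hd s (interior_subset hs)).differentiableAt.differentiableWithinAt
      · intro s hs
        have hs' : a ≤ s := interior_subset hs
        rw [(hd s hs').deriv]
        have := h s hs' (hcon s hs').le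
        rw [one_div] at this
        linarith
    obtain ⟨t, hat, ht⟩ := exists_log_gt (y a) ha
    have h1 := hanti self_mem_Ici (mem_Ici.mpr hat) hat
    simp only at h1
    rw [Real.log_div (ha.trans_le hat).ne' ha.ne'] at ht
    linarith [hcon t hat]
  obtain ⟨s, has, hs⟩ := hex
  filter_upwards [eventually_gt_atTop s] with t hst
  refine (neg_of_barrier hst (fun r hr => hy r (has.trans hr.1)) hs fun r hr h0 => ?_).le
  have h1 := h r (has.trans hr.1) h0.ge
  have : 0 < 1 / r := one_div_pos.mpr (ha.trans_le (has.trans hr.1))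
  linarith

lemma hasDerivAt_div_sq (K : ℝ) {t : ℝ} (ht : t ≠ 0) :
    HasDerivAt (fun t => K / t ^ 2) (-(2 * K / t ^ 3)) t := by
  have h := (hasDerivAt_const t K).div (hasDerivAt_pow 2 t) (pow_ne_zero 2 ht)
  refine h.congr_deriv ?_
  push_cast
  field_simp
  ring

lemma eventually_le_mul_sq (M : ℝ) {c : ℝ} (hc : 0 < c) : ∀ᶠ t : ℝ in atTop, M ≤ c * t ^ 2 :=
  (Tendsto.const_mul_atTop hc (tendsto_pow_atTop two_ne_zero)).eventually_ge_atTop M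

/-- The direction `q = -α` attracts: a solution which does not drop below `-α - 2` satisfies
`q = -α + O(t ^ (-2))`. -/
theorem riccati_slow {δ α m T : ℝ} {q : ℝ → ℝ} (hδ : |δ| < 1) (hT : 0 < T)
    (hq : ∀ t, T ≤ t → HasDerivAt q (-(q t / t) * (q t + m - 2) + t * Phi δ (q t + α)) t)
    (hlow : ∀ t, T ≤ t → -α - 2 ≤ q t) :
    ∃ K, ∀ᶠ t in atTop, |q t + α| ≤ K / t ^ 2 := by
  set c := (1 - |δ|) / 2 with hc
  have hc0 : 0 < c := by rw [hc]; linarith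
  have hδ1 := neg_abs_le δ
  have hδ2 := le_abs_self δ
  -- a bound for the quadratic part
  set K₀ := (m - 2) ^ 2 + (|α| + 2) * (|α| + |m - 2| + 2) with hK₀
  have hK₀' : 0 ≤ K₀ := by positivity
  have hquad : ∀ x, -x * (x + m - 2) ≤ K₀ := by
    intro x
    have : 0 ≤ (|α| + 2) * (|α| + |m - 2| + 2) := by positivity
    nlinarith [sq_nonneg (2 * x + (m - 2)), sq_nonneg (m - 2)]
  have hquad' : ∀ x, -α - 2 ≤ x → x ≤ -α → -K₀ ≤ -x * (x + m - 2) := by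
    intro x h1 h2
    have e1 : |x| ≤ |α| + 2 := by
      rw [abs_le]; constructor <;> linarith [neg_abs_le α, le_abs_self α]
    have e2 : |x + m - 2| ≤ |α| + |m - 2| + 2 := by
      rw [show x + m - 2 = x + (m - 2) by ring]
      refine (abs_add_le _ _).trans ?_
      linarith
    have e3 : x * (x + m - 2) ≤ (|α| + 2) * (|α| + |m - 2| + 2) := by
      refine (le_abs_self _).trans ?_
      rw [abs_mul]
      exact mul_le_mul e1 e2 (abs_nonneg _) (by positivity)
    have := sq_nonneg (m - 2)
    linarith
  set K := 2 * (K₀ + 1) / c with hK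
  have hK0 : 0 < K := by positivity
  have hcK : c * K = 2 * (K₀ + 1) := by rw [hK]; field_simp
  obtain ⟨T₁, hT₁⟩ := eventually_atTop.mp (eventually_le_mul_sq (2 * K) one_pos)
  set a := max T T₁ with ha
  have haT : T ≤ a := le_max_left _ _
  have haT₁ : T₁ ≤ a := le_max_right _ _
  have ha0 : 0 < a := hT.trans_le haT
  have hsmall : ∀ t, a ≤ t → 2 * K / t ^ 3 ≤ 1 / t := by
    intro t ht
    have ht0 : 0 < t := ha0.trans_le ht
    have := hT₁ t (haT₁.trans ht)
    rw [div_le_div_iff₀ (by positivity) ht0]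
    nlinarith
  have hup : ∀ᶠ t in atTop, q t + α - K / t ^ 2 ≤ 0 := by
    refine eventually_nonpos_of_deriv_le ha0 (fun t ht => ((hq t (haT.trans ht)).add_const α).sub
      (hasDerivAt_div_sq K (ha0.trans_le ht).ne')) fun t ht hy => ?_
    have ht0 : 0 < t := ha0.trans_le ht
    have hp : K / t ^ 2 ≤ q t + α := by linarith
    have hp0 : 0 ≤ q t + α := le_trans (by positivity) hp
    rw [Phi_of_nonneg δ hp0]
    have h1 : c * K / t ≤ t * ((1 - δ) / 2 * (q t + α)) := by
      have e1 : c * (K / t ^ 2) ≤ (1 - δ) / 2 * (q t + α) :=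
        mul_le_mul (by rw [hc]; linarith) hp (by positivity) (by linarith)
      calc c * K / t = t * (c * (K / t ^ 2)) := by field_simp
        _ ≤ _ := mul_le_mul_of_nonneg_left e1 ht0.le
    have h2 : -(q t / t) * (q t + m - 2) ≤ K₀ / t := by
      rw [show -(q t / t) * (q t + m - 2) = -q t * (q t + m - 2) / t by ring]
      exact div_le_div_of_nonneg_right (hquad _) ht0.le
    rw [hcK] at h1
    have h3 : 2 * (K₀ + 1) / t = K₀ / t + K₀ / t + 2 * (1 / t) := by ring
    have h4 : 0 ≤ K₀ / t := by positivity
    have := hsmall t ht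
    linarith
  have hdown : ∀ᶠ t in atTop, -(q t + α) - K / t ^ 2 ≤ 0 := by
    refine eventually_nonpos_of_deriv_le ha0 (fun t ht =>
      ((hq t (haT.trans ht)).add_const α).neg.sub
      (hasDerivAt_div_sq K (ha0.trans_le ht).ne')) fun t ht hy => ?_
    have ht0 : 0 < t := ha0.trans_le ht
    have hp : K / t ^ 2 ≤ -(q t + α) := by linarith
    have hp0 : q t + α ≤ 0 := by
      have : 0 ≤ K / t ^ 2 := by positivity
      linarith
    rw [Phi_of_nonpos δ hp0]
    have h1 : c * K / t ≤ t * ((1 + δ) / 2 * (-(q t + α))) := by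
      have e1 : c * (K / t ^ 2) ≤ (1 + δ) / 2 * (-(q t + α)) :=
        mul_le_mul (by rw [hc]; linarith) hp (by positivity) (by linarith)
      calc c * K / t = t * (c * (K / t ^ 2)) := by field_simp
        _ ≤ _ := mul_le_mul_of_nonneg_left e1 ht0.le
    have h2 : -(K₀ / t) ≤ -(q t / t) * (q t + m - 2) := by
      rw [show -(q t / t) * (q t + m - 2) = -q t * (q t + m - 2) / t by ring, ← neg_div]
      exact div_le_div_of_nonneg_right
        (hquad' _ (hlow t (haT.trans ht)) (by linarith)) ht0.le
    rw [hcK] at h1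
    have h3 : 2 * (K₀ + 1) / t = K₀ / t + K₀ / t + 2 * (1 / t) := by ring
    have h4 : 0 ≤ K₀ / t := by positivity
    have := hsmall t ht
    linarith
  refine ⟨K, ?_⟩
  filter_upwards [hup, hdown] with t h1 h2
  rw [abs_le]
  constructor <;> linarith

/-- The direction `q = -∞` repels: a solution which stays below `-α - 2` for all times satisfies
`q = -(1 + δ) / 2 * t ^ 2 + (α - m) + O(t ^ (-2))`. The error `e` solves
`t * e' = (-q - α + 2) * e - (α - 2) * (α - m)`, where `-q - α + 2 ≥ 4`; were it ever too large, it would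
outgrow the bound on `q`, or blow down in finite time. -/
theorem riccati_fast {δ α m T : ℝ} {q : ℝ → ℝ} (hδ : |δ| < 1) (hT : 0 < T)
    (hq : ∀ t, T ≤ t → HasDerivAt q (-(q t / t) * (q t + m - 2) + t * Phi δ (q t + α)) t)
    (hup : ∀ t, T ≤ t → q t ≤ -α - 2) :
    ∃ K, ∀ᶠ t in atTop, |q t + (1 + δ) / 2 * t ^ 2 - (α - m)| ≤ K / t ^ 2 := by
  set c := (1 + δ) / 2 with hc
  have hc0 : 0 < c := by rw [hc]; linarith [neg_abs_le δ]
  set e : ℝ → ℝ := fun t => q t + c * t ^ 2 - (α - m) with he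
  set e' : ℝ → ℝ := fun t => ((-q t - α + 2) * e t - (α - 2) * (α - m)) / t with he'
  set K₁ := |(α - 2) * (α - m)| + 1 with hK₁
  have hK₁1 : 1 ≤ K₁ := by rw [hK₁]; linarith [abs_nonneg ((α - 2) * (α - m))]
  have hA1 : (α - 2) * (α - m) ≤ K₁ - 1 := by rw [hK₁]; linarith [le_abs_self ((α - 2) * (α - m))]
  have hA2 : -((α - 2) * (α - m)) ≤ K₁ - 1 := by
    rw [hK₁]; linarith [neg_abs_le ((α - 2) * (α - m))]
  have hd : ∀ t, T ≤ t → HasDerivAt e (e' t) t := by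
    intro t ht
    have ht0 : 0 < t := hT.trans_le ht
    have h1 := ((hq t ht).add ((hasDerivAt_pow 2 t).const_mul c)).sub_const (α - m)
    refine h1.congr_deriv ?_
    rw [Phi_of_nonpos δ (by linarith [hup t ht])]
    simp only [he', he, ← hc]
    push_cast
    field_simp
    ring
  -- otherwise `e` grows at least like `t ^ 3`, and `q` becomes positive
  have hE1 : ∀ t, T ≤ t → e t < K₁ := by
    intro s hs
    by_contra! hcon
    have hs0 : 0 < s := hT.trans_le hs
    have hge : ∀ t, s ≤ t → K₁ ≤ e t → 3 * e t / t ≤ e' t := by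
      intro t ht h
      have ht0 : 0 < t := hs0.trans_le ht
      apply div_le_div_of_nonneg_right _ ht0.le
      have h1 : 4 ≤ -q t - α + 2 := by linarith [hup t (hs.trans ht)]
      have h2 := mul_le_mul_of_nonneg_right h1 (by linarith : 0 ≤ e t)
      linarith
    have hstay : ∀ t, s ≤ t → K₁ ≤ e t := by
      intro t ht
      rcases ht.eq_or_lt with rfl | ht
      · exact hcon
      have := neg_of_barrier (y := fun t => K₁ - e t) ht
        (fun r hr => (hd r (hs.trans hr.1)).const_sub K₁) (by linarith) (by
          intro r hr h0
          have h1 := hge r hr.1 (by linarith)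
          have h2 : 0 < 3 * e r / r := by
            have := hs0.trans_le hr.1
            have : 0 < e r := by linarith
            positivity
          linarith)
      linarith
    have hmono : MonotoneOn (fun t => e t / t ^ 3) (Ici s) := by
      have hd' : ∀ t, s ≤ t → HasDerivAt (fun t => e t / t ^ 3)
          ((e' t * t ^ 3 - e t * (3 * t ^ 2)) / (t ^ 3) ^ 2) t := by
        intro t ht
        have ht0 : 0 < t := hs0.trans_le ht
        have := (hd t (hs.trans ht)).div (hasDerivAt_pow 3 t) (pow_pos ht0 3).ne'
        refine this.congr_deriv ?_
        norm_num
      apply monotoneOn_of_deriv_nonneg (convex_Ici s)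
      · exact fun t ht => (hd' t ht).continuousAt.continuousWithinAt
      · exact fun t ht => (hd' t (interior_subset ht)).differentiableAt.differentiableWithinAt
      · intro t ht
        have ht' : s ≤ t := interior_subset ht
        have ht0 : 0 < t := hs0.trans_le ht'
        rw [(hd' t ht').deriv]
        apply div_nonneg _ (by positivity)
        have h1 := mul_le_mul_of_nonneg_right (hge t ht' (hstay t ht')) (pow_pos ht0 3).le
        have h2 : 3 * e t / t * t ^ 3 = e t * (3 * t ^ 2) := by field_simp
        linarith
    have hκ : 0 < e s / s ^ 3 := by
      have : 0 < e s := by linarith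
      positivity
    obtain ⟨t, hst, ht1, ht2, ht3⟩ := ((eventually_ge_atTop s).and ((eventually_ge_atTop 1).and
      ((eventually_gt_atTop ((c + |α - m + α + 2|) / (e s / s ^ 3))).and
        (eventually_ge_atTop 0)))).exists
    have h1 : e s / s ^ 3 ≤ e t / t ^ 3 := hmono self_mem_Ici hst hst
    have ht0 : 0 < t := by linarith
    rw [le_div_iff₀ (by positivity)] at h1
    rw [div_lt_iff₀ hκ] at ht2
    have h2 : e t ≤ c * t ^ 2 + |α - m + α + 2| := by
      have := hup t (hs.trans hst)
      have := neg_abs_le (α - m + α + 2)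
      simp only [he]
      linarith
    have h3 : (c + |α - m + α + 2|) * t ^ 2 < t * (e s / s ^ 3) * t ^ 2 :=
      mul_lt_mul_of_pos_right ht2 (by positivity)
    have h4 : |α - m + α + 2| ≤ |α - m + α + 2| * t ^ 2 :=
      le_mul_of_one_le_right (abs_nonneg _) (one_le_pow₀ ht1)
    nlinarith
  -- otherwise `e' ≤ -e ^ 2 / (2 * t)` from some time on, and `e` blows down in finite time
  obtain ⟨T₁, hT₁⟩ := eventually_atTop.mp
    (eventually_le_mul_sq (2 * (α - m + α - 2 + K₁) + 2 * K₁) hc0)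
  set a := max T T₁ with ha
  have haT : T ≤ a := le_max_left _ _
  have ha0 : 0 < a := hT.trans_le haT
  have hqe : ∀ t, -q t - α + 2 = c * t ^ 2 - (α - m + α - 2) - e t := by
    intro t; simp only [he]; ring
  have hT₁' : ∀ t, a ≤ t → 2 * (α - m + α - 2 + K₁) + 2 * K₁ ≤ c * t ^ 2 := fun t ht =>
    hT₁ t ((le_max_right _ _).trans ht)
  have hE2 : ∀ t, a ≤ t → -(2 * K₁) < e t := by
    intro s hs
    by_contra! hcon
    have hs0 : 0 < s := ha0.trans_le hs
    have hle : ∀ t, s ≤ t → e t ≤ -(2 * K₁) → e' t ≤ -(e t ^ 2 / (2 * t)) := by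
      intro t ht h
      have ht0 : 0 < t := hs0.trans_le ht
      rw [show -(e t ^ 2 / (2 * t)) = -(e t ^ 2 / 2) / t by field_simp]
      apply div_le_div_of_nonneg_right _ ht0.le
      have h0 : -e t ≤ -q t - α + 2 := by
        rw [hqe]
        nlinarith [hT₁' t (hs.trans ht), mul_pos hc0 (pow_pos ht0 2)]
      have h2 := mul_le_mul_of_nonpos_right h0 (by linarith : e t ≤ 0)
      nlinarith
    have hstay : ∀ t, s ≤ t → e t ≤ -(2 * K₁) := by
      intro t ht
      rcases ht.eq_or_lt with rfl | ht
      · exact hcon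
      have := neg_of_barrier (y := fun t => e t + 2 * K₁) ht
        (fun r hr => (hd r (haT.trans (hs.trans hr.1))).add_const (2 * K₁)) (by linarith) (by
          intro r hr h0
          have h1 := hle r hr.1 (by linarith)
          have h2 : 0 < e r ^ 2 / (2 * r) := by
            have := hs0.trans_le hr.1
            have h3 : e r ≠ 0 := by intro h; rw [h] at h0; linarith
            positivity
          linarith)
      linarith
    -- `-2 / e` decreases at least like `-log`, but it is positive
    have hd' : ∀ t, s ≤ t → HasDerivAt (fun t => (-2) / e t - (-2) / e s)
        ((0 * e t - (-2) * e' t) / e t ^ 2) t := by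
      intro t ht
      have hne : e t ≠ 0 := by have := hstay t ht; intro h; rw [h] at this; linarith
      exact ((hasDerivAt_const t (-2)).div (hd t (haT.trans (hs.trans ht))) hne).sub_const _
    obtain ⟨t, hst, hlog⟩ := exists_log_gt (-((-2) / e s) + 2 * ((-2) / e s)) hs0
    have h1 := le_neg_log_of_deriv_le hs0 hd' (by simp) (by
      intro t ht _
      have ht0 : 0 < t := hs0.trans_le ht
      have h2 := hle t ht (hstay t ht)
      have hne : e t ≠ 0 := by have := hstay t ht; intro h; rw [h] at this; linarith
      rw [div_le_iff₀ (by positivity)]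
      have h3 : e t ^ 2 / (2 * t) * 2 = 1 / t * e t ^ 2 := by field_simp
      linarith) hst
    have h4 : 0 < (-2) / e t :=
      div_pos_of_neg_of_neg (by norm_num) (by have := hstay t hst; linarith)
    linarith
  -- once bounded, `e` obeys `t * e' = (c * t ^ 2 + O(1)) * e + O(1)`, so that it would leave every
  -- bounded set if `|e| ≥ K / t ^ 2` at some late time
  set K := 2 * (K₁ + 1) / c with hK
  have hK0 : 0 < K := by positivity
  have hcK : c * K = 2 * (K₁ + 1) := by rw [hK]; field_simp
  have hbig : ∀ t, a ≤ t → c / 2 * t ^ 2 ≤ -q t - α + 2 := by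
    intro t ht
    rw [hqe]
    linarith [hT₁' t ht, hE1 t (haT.trans ht)]
  have hU : ∀ s, a ≤ s → e s < K / s ^ 2 := by
    intro s hs
    by_contra! hcon
    have hs0 : 0 < s := ha0.trans_le hs
    obtain ⟨t, hst, hlog⟩ := exists_log_gt K₁ hs0
    have h1 := le_neg_log_of_deriv_le (y := fun t => K / t ^ 2 - e t) hs0
      (fun t ht => (hasDerivAt_div_sq K (hs0.trans_le ht).ne').sub
        (hd t (haT.trans (hs.trans ht)))) (by linarith) (by
      intro t ht h2
      have ht0 : 0 < t := hs0.trans_le ht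
      have h3 : K / t ^ 2 ≤ e t := by linarith
      have h4 : c / 2 * t ^ 2 * (K / t ^ 2) ≤ (-q t - α + 2) * e t :=
        mul_le_mul (hbig t (hs.trans ht)) h3 (by positivity)
          (le_trans (by positivity) (hbig t (hs.trans ht)))
      have h5 : c / 2 * t ^ 2 * (K / t ^ 2) = K₁ + 1 := by
        field_simp; linarith
      have h6 : 1 / t ≤ e' t := by
        apply div_le_div_of_nonneg_right _ ht0.le
        linarith
      have h7 : 0 ≤ 2 * K / t ^ 3 := by positivity
      linarith) hst
    have h8 : 0 < K / t ^ 2 := by have := hs0.trans_le hst; positivity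
    linarith [hE1 t (haT.trans (hs.trans hst))]
  have hL : ∀ s, a ≤ s → -(K / s ^ 2) < e s := by
    intro s hs
    by_contra! hcon
    have hs0 : 0 < s := ha0.trans_le hs
    obtain ⟨t, hst, hlog⟩ := exists_log_gt (2 * K₁) hs0
    have h1 := le_neg_log_of_deriv_le (y := fun t => K / t ^ 2 + e t) hs0
      (fun t ht => (hasDerivAt_div_sq K (hs0.trans_le ht).ne').add
        (hd t (haT.trans (hs.trans ht)))) (by linarith) (by
      intro t ht h2
      have ht0 : 0 < t := hs0.trans_le ht
      have h3 : K / t ^ 2 ≤ -e t := by linarith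
      have h4 : c / 2 * t ^ 2 * (K / t ^ 2) ≤ (-q t - α + 2) * (-e t) :=
        mul_le_mul (hbig t (hs.trans ht)) h3 (by positivity)
          (le_trans (by positivity) (hbig t (hs.trans ht)))
      have h5 : c / 2 * t ^ 2 * (K / t ^ 2) = K₁ + 1 := by
        field_simp; linarith
      have h6 : e' t ≤ -(1 / t) := by
        rw [← neg_div]
        apply div_le_div_of_nonneg_right _ ht0.le
        linarith
      have h7 : 0 ≤ 2 * K / t ^ 3 := by positivity
      linarith) hst
    have h8 : 0 < K / t ^ 2 := by have := hs0.trans_le hst; positivity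
    linarith [hE2 t (hs.trans hst)]
  refine ⟨K, ?_⟩
  filter_upwards [eventually_ge_atTop a] with t ht
  rw [abs_le]
  exact ⟨(hL t ht).le, (hU t ht).le⟩

/-- A positive function whose logarithmic derivative is `O(t ^ (-3))` has a positive limit. -/
lemma exists_tendsto_of_logDeriv {h k : ℝ → ℝ} {T K : ℝ} (hT : 0 < T)
    (hpos : ∀ t, T ≤ t → 0 < h t) (hd : ∀ t, T ≤ t → HasDerivAt h (h t * (k t / t)) t)
    (hk : ∀ t, T ≤ t → |k t| ≤ K / t ^ 2) : ∃ C, 0 < C ∧ Tendsto h atTop (𝓝 C) := by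
  have hlog : ∀ t, T ≤ t → HasDerivAt (fun t => Real.log (h t)) (k t / t) t := by
    intro t ht
    refine ((hd t ht).log (hpos t ht).ne').congr_deriv ?_
    rw [mul_div_cancel_left₀ _ (hpos t ht).ne']
  have hk1 : ∀ t, T ≤ t → |k t / t| ≤ K / t ^ 3 := by
    intro t ht
    have ht0 : 0 < t := hT.trans_le ht
    rw [abs_div, abs_of_pos ht0, div_le_iff₀ ht0]
    refine (hk t ht).trans_eq ?_
    field_simp
  have hK : 0 ≤ K := by
    have h1 := (abs_nonneg _).trans (hk T le_rfl)
    by_contra! hneg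
    exact absurd h1 (not_le.mpr (div_neg_of_neg_of_pos hneg (by positivity)))
  have hdv : ∀ t, T ≤ t → HasDerivAt (fun t => K / 2 / t ^ 2) (-(K / t ^ 3)) t := by
    intro t ht
    refine (hasDerivAt_div_sq (K / 2) (hT.trans_le ht).ne').congr_deriv ?_
    ring
  have hmono : MonotoneOn (fun t => Real.log (h t) - K / 2 / t ^ 2) (Ici T) := by
    have hd' := fun t (ht : T ≤ t) => (hlog t ht).sub (hdv t ht)
    apply monotoneOn_of_deriv_nonneg (convex_Ici T)
    · exact fun t ht => (hd' t ht).continuousAt.continuousWithinAt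
    · exact fun t ht => (hd' t (interior_subset ht)).differentiableAt.differentiableWithinAt
    · intro t ht
      have ht' : T ≤ t := interior_subset ht
      have := (hd' t ht').deriv
      have h2 := neg_abs_le (k t / t)
      have h3 := hk1 t ht'
      refine le_of_le_of_eq ?_ this.symm
      linarith
  have hanti : AntitoneOn (fun t => Real.log (h t) + K / 2 / t ^ 2) (Ici T) := by
    have hd' := fun t (ht : T ≤ t) => (hlog t ht).add (hdv t ht)
    apply antitoneOn_of_deriv_nonpos (convex_Ici T)
    · exact fun t ht => (hd' t ht).continuousAt.continuousWithinAt
    · exact fun t ht => (hd' t (interior_subset ht)).differentiableAt.differentiableWithinAt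
    · intro t ht
      have ht' : T ≤ t := interior_subset ht
      have := (hd' t ht').deriv
      have h2 := le_abs_self (k t / t)
      have h3 := hk1 t ht'
      refine le_of_eq_of_le this ?_
      linarith
  set u : ℝ → ℝ := fun t => Real.log (h (max t T)) - K / 2 / (max t T) ^ 2 with hu
  have humono : Monotone u := fun s t hst =>
    hmono (mem_Ici.mpr (le_max_right _ _)) (mem_Ici.mpr (le_max_right _ _)) (max_le_max_right T hst)
  have hbdd : BddAbove (range u) := by
    refine ⟨Real.log (h T) + K / 2 / T ^ 2, ?_⟩
    rintro _ ⟨t, rfl⟩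
    have h1 := hanti self_mem_Ici (mem_Ici.mpr (le_max_right t T)) (le_max_right t T)
    have h2 : 0 ≤ K / 2 / (max t T) ^ 2 := by positivity
    simp only at h1
    simp only [hu]
    linarith
  have hlim := tendsto_atTop_ciSup humono hbdd
  set l := ⨆ i, u i
  have hzero : Tendsto (fun t : ℝ => K / 2 / t ^ 2) atTop (𝓝 0) :=
    tendsto_const_nhds.div_atTop (tendsto_pow_atTop two_ne_zero)
  have h3 := (hlim.add hzero).rexp
  rw [add_zero] at h3
  refine ⟨Real.exp l, Real.exp_pos l, h3.congr' ?_⟩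
  filter_upwards [eventually_ge_atTop T] with t ht
  simp only [hu, max_eq_left ht, sub_add_cancel]
  exact Real.exp_log (hpos t ht)

/-! ### Slow and fast decay of the profiles -/

lemma arctan_tan_of_mem_sector {x : ℝ} {k : ℕ} (hx : x ∈ Ioo (level (k + 1)) (level k)) :
    Real.arctan (Real.tan x) = x + k * Real.pi := by
  rw [← Real.tan_add_nat_mul_pi x k]
  have h1 := hx.1
  have h2 := hx.2
  unfold level at h1 h2
  push_cast at h1
  apply Real.arctan_tan <;> linarith

lemma floorAngle_le_iff {α x : ℝ} {k : ℕ} (hx : x ∈ Ioo (level (k + 1)) (level k)) :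
    floorAngle α k ≤ x ↔ -α - 2 ≤ Real.tan x := by
  rw [← Real.arctan_strictMono.le_iff_le (a := -α - 2), arctan_tan_of_mem_sector hx]
  unfold floorAngle
  constructor <;> intro h <;> linarith

lemma le_floorAngle_iff {α x : ℝ} {k : ℕ} (hx : x ∈ Ioo (level (k + 1)) (level k)) :
    x ≤ floorAngle α k ↔ Real.tan x ≤ -α - 2 := by
  rw [← Real.arctan_strictMono.le_iff_le (b := -α - 2), arctan_tan_of_mem_sector hx]
  unfold floorAngle
  constructor <;> intro h <;> linarith

lemma tan_le_tan_of_mem_sector {x y : ℝ} {k : ℕ} (hx : x ∈ Ioo (level (k + 1)) (level k))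
    (hy : y ∈ Ioo (level (k + 1)) (level k)) (h : x ≤ y) : Real.tan x ≤ Real.tan y := by
  rw [← Real.arctan_le_arctan_iff, arctan_tan_of_mem_sector hx, arctan_tan_of_mem_sector hy]
  linarith

lemma exists_cos_eq_of_mem_sector {x : ℝ} {k : ℕ} (hx : x ∈ Ioo (level (k + 1)) (level k)) :
    ∃ c, 0 < c ∧ Real.cos x = (-1) ^ k * c := by
  refine ⟨Real.cos (x + k * Real.pi), ?_, ?_⟩
  · have h1 := hx.1
    have h2 := hx.2
    unfold level at h1 h2
    push_cast at h1
    apply Real.cos_pos_of_mem_Ioo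
    constructor <;> linarith
  · rw [Real.cos_add_nat_mul_pi, ← mul_assoc, ← mul_pow]; simp

lemma exists_level_le (x : ℝ) : ∃ k, level k ≤ x := by
  obtain ⟨k, hk⟩ := exists_nat_ge ((Real.pi / 2 - x) / Real.pi)
  refine ⟨k, ?_⟩
  rw [div_le_iff₀ Real.pi_pos] at hk
  unfold level
  linarith

/-- The exponents for which the angle passes below `level (k + 1)`, that is, for which the profile has at
least `k + 1` zeros. -/
def crossing (θ : ℝ → ℝ → ℝ) (k : ℕ) : Set ℝ := {α | ∃ t, 0 < t ∧ θ α t < level (k + 1)}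

/-- From some time on, the profile with exponent `α` has exactly `k` zeros behind it. -/
def InSector (θ : ℝ → ℝ → ℝ) (α : ℝ) (k : ℕ) : Prop :=
  ∀ᶠ t in atTop, θ α t ∈ Ioo (level (k + 1)) (level k)

namespace IsPolar

variable {N : ℕ} {γ : ℝ} {F G θ ρ : ℝ → ℝ → ℝ}

lemma hasDerivAt_tan (P : IsPolar N γ F G θ ρ) {α t : ℝ} {k : ℕ} (ht : 0 < t)
    (hs : θ α t ∈ Ioo (level (k + 1)) (level k)) :
    HasDerivAt (fun t => Real.tan (θ α t)) (-(Real.tan (θ α t) / t) *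
      (Real.tan (θ α t) + N - 2) + t * Phi ((-1) ^ k * γ) (Real.tan (θ α t) + α)) t := by
  obtain ⟨c, hc, hcos⟩ := exists_cos_eq_of_mem_sector hs
  have hne : Real.cos (θ α t) ≠ 0 := by
    rw [hcos]; exact mul_ne_zero (pow_ne_zero _ (by norm_num)) hc.ne'
  refine ((Real.hasDerivAt_tan hne).comp t (P.hasDerivAt α t ht)).congr_deriv ?_
  rw [angleField_eq N γ α k hc hcos (Real.tan_mul_cos hne).symm]
  have hsq : Real.cos (θ α t) ^ 2 = c ^ 2 := by
    rw [hcos, mul_pow, ← pow_mul, mul_comm k, pow_mul]; simp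
  rw [hsq]
  field_simp

lemma pos_of_mem_sector (P : IsPolar N γ F G θ ρ) {α t : ℝ} {k : ℕ} (ht : 0 ≤ t)
    (hs : θ α t ∈ Ioo (level (k + 1)) (level k)) : 0 < (-1) ^ k * F α t := by
  obtain ⟨c, hc, hcos⟩ := exists_cos_eq_of_mem_sector hs
  rw [P.F_eq α t ht, hcos]
  have h2 : ((-1 : ℝ) ^ k) ^ 2 = 1 := by rw [← pow_mul, mul_comm, pow_mul]; simp
  have h3 : (-1) ^ k * (ρ α t * ((-1) ^ k * c)) = ρ α t * c := by linear_combination ρ α t * c * h2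
  rw [h3]
  exact mul_pos (P.radius_pos α t ht) hc

lemma hasDerivAt_F (P : IsPolar N γ F G θ ρ) {α t : ℝ} {k : ℕ} (ht : 0 < t)
    (hs : θ α t ∈ Ioo (level (k + 1)) (level k)) :
    HasDerivAt (F α) (F α t * (Real.tan (θ α t) / t)) t := by
  refine ((P.isSolution α).hasDerivAt_f t ht).congr_deriv ?_
  obtain ⟨c, hc, hcos⟩ := exists_cos_eq_of_mem_sector hs
  have hne : Real.cos (θ α t) ≠ 0 := by
    rw [hcos]; exact mul_ne_zero (pow_ne_zero _ (by norm_num)) hc.ne'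
  have h1 := P.G_eq α t ht.le
  rw [P.F_eq α t ht.le, Real.tan_eq_sin_div_cos]
  field_simp
  linarith

/-- The slope `tan θ = t * f' / f` is `t` times the logarithmic derivative of the profile; its expansion
yields the decay of the profile by integration. -/
lemma exists_tendsto_mul_weight (P : IsPolar N γ F G θ ρ) {α : ℝ} {k : ℕ}
    (hs : InSector θ α k) {r s K : ℝ}
    (hK : ∀ᶠ t in atTop, |Real.tan (θ α t) + 2 * s * t ^ 2 + r| ≤ K / t ^ 2) :
    ∃ C, C ≠ 0 ∧ Tendsto (fun t => F α t * (t ^ r * Real.exp (s * t ^ 2))) atTop (𝓝 C) := by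
  obtain ⟨T, hT⟩ := eventually_atTop.mp ((hs.and hK).and (eventually_gt_atTop 0))
  have hT0 : 0 < T := (hT T le_rfl).2
  obtain ⟨C, hC, hlim⟩ := exists_tendsto_of_logDeriv
    (h := fun t => (-1) ^ k * (F α t * (t ^ r * Real.exp (s * t ^ 2))))
    (k := fun t => Real.tan (θ α t) + 2 * s * t ^ 2 + r) hT0
    (fun t ht => by
      have ht0 := (hT t ht).2
      rw [← mul_assoc]
      have := P.pos_of_mem_sector ht0.le (hT t ht).1.1
      positivity)
    (fun t ht => by
      have ht0 := (hT t ht).2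
      have h1 := P.hasDerivAt_F ht0 (hT t ht).1.1
      have h2 := Real.hasDerivAt_rpow_const (x := t) (p := r) (Or.inl ht0.ne')
      have h3 := ((hasDerivAt_pow 2 t).const_mul s).exp
      refine ((h1.mul (h2.mul h3)).const_mul _).congr_deriv ?_
      rw [Real.rpow_sub_one ht0.ne']
      simp only [Pi.mul_apply]
      push_cast
      field_simp
      ring)
    (fun t ht => (hT t ht).1.2)
  have h2 : ((-1 : ℝ) ^ k) ^ 2 = 1 := by rw [← pow_mul, mul_comm, pow_mul]; simp
  refine ⟨(-1) ^ k * C, mul_ne_zero (pow_ne_zero _ (by norm_num)) hC.ne',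
    (hlim.const_mul ((-1) ^ k)).congr fun t => ?_⟩
  linear_combination (F α t * (t ^ r * Real.exp (s * t ^ 2))) * h2

/-- If the angle ever lies above the floor at a late time, the profile decays slowly. -/
theorem asympTo_slow (P : IsPolar N γ F G θ ρ) {α R : ℝ} {k : ℕ} (hs : InSector θ α k)
    (hR : 0 < R) (hpos : ∀ t, R ≤ t → 0 < angleField N γ α t (floorAngle α k))
    {s : ℝ} (hsR : R ≤ s) (hf : floorAngle α k < θ α s) :
    AsympTo (F α) fun t => t ^ (-α) := by
  obtain ⟨T, hT⟩ := eventually_atTop.mp (hs.and (eventually_gt_atTop s))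
  have hT0 : 0 < T := hR.trans_le (hsR.trans (hT T le_rfl).2.le)
  obtain ⟨K, hK⟩ := riccati_slow (T := T) (q := fun t => Real.tan (θ α t)) (m := N) (α := α)
    (δ := (-1) ^ k * γ) (by rw [abs_neg_one_pow_mul]; exact P.abs_lt_one) hT0
    (fun t ht => P.hasDerivAt_tan (hT0.trans_le ht) (hT t ht).1)
    (fun t ht => (floorAngle_le_iff (hT t ht).1).mp
      (P.floorAngle_lt hR hpos hsR hf.le (hT t ht).2).le)
  obtain ⟨C, hC, hlim⟩ := P.exists_tendsto_mul_weight hs (r := α) (s := 0) (K := K)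
    (hK.mono fun t ht => by simpa using ht)
  refine ⟨C, hC, hlim.congr' ?_⟩
  filter_upwards [eventually_gt_atTop 0] with t ht
  rw [Real.rpow_neg ht.le]
  simp

lemma tan_asymp_of_fast (P : IsPolar N γ F G θ ρ) {α : ℝ} {k : ℕ} (hs : InSector θ α k)
    (hf : ∀ᶠ t in atTop, Real.tan (θ α t) ≤ -α - 2) :
    ∃ K, ∀ᶠ t in atTop,
      |Real.tan (θ α t) + (1 + (-1) ^ k * γ) / 2 * t ^ 2 - (α - N)| ≤ K / t ^ 2 := by
  obtain ⟨T, hT⟩ := eventually_atTop.mp ((hs.and hf).and (eventually_gt_atTop 0))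
  have hT0 : 0 < T := (hT T le_rfl).2
  exact riccati_fast (T := T) (q := fun t => Real.tan (θ α t)) (m := N) (α := α)
    (δ := (-1) ^ k * γ) (by rw [abs_neg_one_pow_mul]; exact P.abs_lt_one) hT0
    (fun t ht => P.hasDerivAt_tan (hT0.trans_le ht) (hT t ht).1.1)
    (fun t ht => (hT t ht).1.2)

/-- If the angle stays below the floor, the profile decays like a Gaussian. -/
theorem asympTo_fast (P : IsPolar N γ F G θ ρ) {α : ℝ} {k : ℕ} (hs : InSector θ α k)
    (hf : ∀ᶠ t in atTop, Real.tan (θ α t) ≤ -α - 2) :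
    AsympTo (F α) fun t =>
      t ^ (α - (N : ℝ)) * Real.exp (-((1 + (-1) ^ k * γ) / 4) * t ^ 2) := by
  obtain ⟨K, hK⟩ := P.tan_asymp_of_fast hs hf
  obtain ⟨C, hC, hlim⟩ := P.exists_tendsto_mul_weight hs (r := -(α - N))
    (s := (1 + (-1) ^ k * γ) / 4) (K := K) (hK.mono fun t ht => by
      convert ht using 2
      ring)
  refine ⟨C, hC, hlim.congr' ?_⟩
  filter_upwards [eventually_gt_atTop 0] with t ht
  rw [Real.rpow_neg ht.le, neg_mul, Real.exp_neg]
  field_simp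

lemma level_lt_of_notMem (P : IsPolar N γ F G θ ρ) {α : ℝ} {k : ℕ} (h : α ∉ crossing θ k)
    {t : ℝ} (ht : 0 ≤ t) : level (k + 1) < θ α t := by
  rcases ht.eq_or_lt with rfl | ht
  · rw [P.angle_zero, level_succ]
    unfold level
    have : (0 : ℝ) ≤ k * Real.pi := by positivity
    linarith [Real.pi_pos]
  by_contra! hcon
  exact h ⟨t + 1, by linarith, P.lt_level ht hcon (lt_add_one t)⟩

lemma crossing_succ_subset (k : ℕ) : crossing θ (k + 1) ⊆ crossing θ k :=
  fun _ ⟨t, ht, h⟩ => ⟨t, ht, h.trans (level_strictAnti (Nat.lt_succ_self _))⟩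

lemma inSector (P : IsPolar N γ F G θ ρ) {α : ℝ} {k : ℕ} (h : α ∉ crossing θ k)
    (h' : ∀ j, j + 1 = k → α ∈ crossing θ j) : InSector θ α k := by
  rcases k with _ | j
  · filter_upwards [eventually_ge_atTop 0] with t ht
    exact ⟨P.level_lt_of_notMem h ht, P.lt_level_zero α ht⟩
  · obtain ⟨s, hs, hs'⟩ := h' j rfl
    filter_upwards [eventually_gt_atTop s] with t ht
    exact ⟨P.level_lt_of_notMem h (hs.trans ht).le, P.lt_level hs hs'.le ht⟩

lemma notMem_crossing_of_floorAngle_lt (P : IsPolar N γ F G θ ρ) {α R s : ℝ} {k : ℕ}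
    (hR : 0 < R) (hpos : ∀ t, R ≤ t → 0 < angleField N γ α t (floorAngle α k))
    (hsR : R ≤ s) (hf : floorAngle α k < θ α s) : α ∉ crossing θ k := by
  rintro ⟨t, ht, h⟩
  have h1 : θ α (max s t + 1) < level (k + 1) :=
    P.lt_level ht h.le (lt_of_le_of_lt (le_max_right s t) (lt_add_one _))
  have h2 := P.floorAngle_lt hR hpos hsR hf.le
    (lt_of_le_of_lt (le_max_left s t) (lt_add_one _))
  linarith [level_lt_floorAngle α k]

/-- Slow decay without further zeros is stable under small changes of the exponent. -/
lemma eventually_notMem_crossing (P : IsPolar N γ F G θ ρ) {α R s B : ℝ} {k : ℕ}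
    (hR : 0 < R)
    (hpos : ∀ β, |β| ≤ B → ∀ t, R ≤ t → ∀ k, 0 < angleField N γ β t (floorAngle β k))
    (hB : |α| < B) (hsR : R ≤ s) (hf : floorAngle α k < θ α s) :
    ∀ᶠ β in 𝓝 α, β ∉ crossing θ k := by
  have h1 : ∀ᶠ β in 𝓝 α, |β| < B := continuous_abs.continuousAt.eventually_lt_const hB
  have hc : Continuous fun β => floorAngle β k := by
    have := Real.continuous_arctan
    unfold floorAngle
    fun_prop
  have h2 : ∀ᶠ β in 𝓝 α, floorAngle β k < θ β s :=
    hc.continuousAt.eventually_lt (P.continuous_param s).continuousAt hf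
  filter_upwards [h1, h2] with β hβ1 hβ2
  exact P.notMem_crossing_of_floorAngle_lt hR (fun t ht => hpos β hβ1.le t ht k) hsR hβ2

lemma exists_notMem_crossing (P : IsPolar N γ F G θ ρ) (α : ℝ) : ∃ k, α ∉ crossing θ k := by
  obtain ⟨R, hR, hpos⟩ := exists_angleField_floorAngle_pos N P.abs_lt_one |α|
  obtain ⟨k, hk⟩ := exists_level_le (θ α R)
  exact ⟨k, P.notMem_crossing_of_floorAngle_lt hR (fun t ht => hpos α le_rfl t ht k) le_rfl
    ((floorAngle_lt_level α k).trans_le hk)⟩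

lemma mem_crossing_of_lt (P : IsPolar N γ F G θ ρ) {α β : ℝ} {k : ℕ} (h : α ∈ crossing θ k)
    (hαβ : α < β) : β ∈ crossing θ k := by
  obtain ⟨t, ht, h⟩ := h
  exact ⟨t, ht, (P.angle_lt hαβ ht).trans h⟩

lemma isOpen_crossing (P : IsPolar N γ F G θ ρ) (k : ℕ) : IsOpen (crossing θ k) := by
  have : crossing θ k = ⋃ t ∈ Ioi (0 : ℝ), {α | θ α t < level (k + 1)} := by
    ext α; simp [crossing]
  rw [this]
  exact isOpen_biUnion fun t _ => isOpen_lt (P.continuous_param t) continuous_const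

/-- If the profile with exponent `α` decays fast after `k` zeros, then every larger exponent gives at
least one more zero: otherwise its profile would decay fast, too, with a smaller slope, whereas the
slopes of two such profiles differ by `β - α + o(1)` in the other direction. -/
theorem mem_crossing_of_fast (P : IsPolar N γ F G θ ρ) {α β : ℝ} {k : ℕ}
    (hs : InSector θ α k) (hf : ∀ᶠ t in atTop, Real.tan (θ α t) ≤ -α - 2) (hαβ : α < β) :
    β ∈ crossing θ k := by
  by_contra hβ
  have hsβ : InSector θ β k := by
    filter_upwards [hs, eventually_gt_atTop 0] with t ht ht0
    exact ⟨P.level_lt_of_notMem hβ ht0.le, (P.angle_lt hαβ ht0).trans ht.2⟩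
  have hle : ∀ᶠ t in atTop, Real.tan (θ β t) ≤ Real.tan (θ α t) := by
    filter_upwards [hs, hsβ, eventually_gt_atTop 0] with t h1 h2 ht0
    exact tan_le_tan_of_mem_sector h2 h1 (P.angle_lt hαβ ht0).le
  obtain ⟨K, hK⟩ := P.tan_asymp_of_fast hs hf
  set c := (1 + (-1) ^ k * γ) / 2 with hc
  have hc0 : 0 < c := by
    have h1 := neg_abs_le ((-1) ^ k * γ)
    rw [abs_neg_one_pow_mul] at h1
    have := P.abs_lt_one
    rw [hc]; linarith
  have hzero : ∀ K : ℝ, Tendsto (fun t : ℝ => K / t ^ 2) atTop (𝓝 0) := fun K =>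
    tendsto_const_nhds.div_atTop (tendsto_pow_atTop two_ne_zero)
  have hfβ : ∀ᶠ t in atTop, Real.tan (θ β t) ≤ -β - 2 := by
    filter_upwards [hle, hK, (hzero K).eventually_le_const one_pos,
      eventually_le_mul_sq (1 + (α - N) + β + 2) hc0] with t h1 h2 h3 h4
    have := (abs_le.mp h2).2
    linarith
  obtain ⟨K', hK'⟩ := P.tan_asymp_of_fast hsβ hfβ
  rw [← hc] at hK'
  have hgap : 0 < (β - α) / 2 := by linarith
  obtain ⟨t, h1, h2, h3, h4, h5⟩ := (hle.and (hK.and (hK'.and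
    (((hzero K).eventually_lt_const hgap).and ((hzero K').eventually_lt_const hgap))))).exists
  have h6 := (abs_le.mp h2).2
  have h7 := (abs_le.mp h3).1
  linarith

end IsPolar

/-! ### Oscillation for large exponents -/

/-- For large `β` the Riccati field dominates `-(q ^ 2 + μ ^ 2) / 4` on `[1, 2]`. -/
lemma exists_riccati_le (N : ℕ) {γ : ℝ} (hγ : |γ| < 1) (μ : ℝ) :
    ∃ β : ℝ, ∀ t ∈ Icc (1 : ℝ) 2, ∀ δ q : ℝ, |δ| = |γ| →
      -(q / t) * (q + N - 2) + t * Phi δ (q + β) ≤ -((q ^ 2 + μ ^ 2) / 4) := by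
  set c := (1 - |γ|) / 2 with hc
  have hc0 : 0 < c := by rw [hc]; linarith
  have hc1 : c ≤ 1 := by rw [hc]; linarith [abs_nonneg γ]
  have hN : (0 : ℝ) ≤ N := Nat.cast_nonneg N
  set β := (8 * ((N : ℝ) + 4) ^ 2 + 2 * μ ^ 2 + 1) / c with hβ
  have hcβ : c * β = 8 * ((N : ℝ) + 4) ^ 2 + 2 * μ ^ 2 + 1 := by rw [hβ]; field_simp
  have hβ1 : 8 * ((N : ℝ) + 4) ^ 2 + 2 * μ ^ 2 + 1 ≤ β := by
    rw [hβ, le_div_iff₀ hc0]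
    exact mul_le_of_le_one_right (by positivity) hc1
  refine ⟨β, fun t ht δ q hδ => ?_⟩
  have ht0 : 0 < t := by linarith [ht.1]
  have hδ1 := neg_abs_le δ
  have hδ2 := le_abs_self δ
  have hμ := sq_nonneg μ
  have h1 : -(q / t) * (q + N - 2) ≤ -(q ^ 2 / 2) + (N + 2) * |q| := by
    have e1 : q ^ 2 / 2 ≤ q ^ 2 / t := div_le_div_of_nonneg_left (sq_nonneg q) ht0 ht.2
    have e2 : -(q * (N - 2)) / t ≤ (N + 2) * |q| := by
      rw [div_le_iff₀ ht0]
      have e3 : -(q * ((N : ℝ) - 2)) ≤ (N + 2) * |q| := by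
        refine (neg_le_abs _).trans ?_
        rw [abs_mul, mul_comm]
        apply mul_le_mul_of_nonneg_right _ (abs_nonneg q)
        rw [abs_le]; constructor <;> linarith
      have e4 : 0 ≤ ((N : ℝ) + 2) * |q| := by positivity
      nlinarith [ht.1]
    have : -(q / t) * (q + N - 2) = -(q ^ 2 / t) + -(q * (N - 2)) / t := by field_simp; ring
    linarith
  have hqa := neg_abs_le q
  rcases le_total 0 (q + β) with hp | hp
  · have h2 : t * Phi δ (q + β) ≤ |q| - c * β := by
      rw [Phi_of_nonneg δ hp]
      have e1 : c * (q + β) ≤ (1 - δ) / 2 * (q + β) :=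
        mul_le_mul_of_nonneg_right (by rw [hc]; linarith) hp
      have e2 : 0 ≤ c * (q + β) := mul_nonneg hc0.le hp
      have e3 : -(c * q) ≤ |q| := by
        refine (neg_le_abs _).trans ?_
        rw [abs_mul, abs_of_pos hc0]
        exact mul_le_of_le_one_left (abs_nonneg q) hc1
      nlinarith [ht.1]
    have h3 : (N + 3) * |q| ≤ q ^ 2 / 4 + ((N : ℝ) + 3) ^ 2 := by
      have := sq_nonneg (|q| / 2 - ((N : ℝ) + 3))
      have e := sq_abs q
      nlinarith
    nlinarith
  · have hq : q ≤ -β := by linarith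
    have hβ0 : 0 ≤ β := le_trans (by positivity) hβ1
    have habs : |q| = -q := abs_of_nonpos (by linarith)
    have h2 : t * Phi δ (q + β) ≤ 2 * |q| := by
      rw [Phi_of_nonpos δ hp, habs]
      have e1 : -((1 + δ) / 2) * (q + β) ≤ -q := by nlinarith
      have e2 : 0 ≤ -((1 + δ) / 2) * (q + β) := by nlinarith
      nlinarith [ht.2]
    have h3 : 8 * ((N : ℝ) + 4) ≤ |q| := by rw [habs]; nlinarith
    have h4 : 2 * μ ^ 2 ≤ |q| := by rw [habs]; nlinarith
    have h5 : 1 ≤ |q| := by rw [habs]; nlinarith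
    have e := sq_abs q
    nlinarith

namespace IsPolar

variable {N : ℕ} {γ : ℝ} {F G θ ρ : ℝ → ℝ → ℝ}

/-- The time spent in one sector is at most `32 / μ`, because `arctan (q / μ)` decreases at least at the
rate `μ / 4`. -/
lemma lt_level_succ_of_riccati_le (P : IsPolar N γ F G θ ρ) {β μ a b : ℝ} {j : ℕ} (hμ : 0 < μ)
    (hβ : ∀ t ∈ Icc (1 : ℝ) 2, ∀ δ q : ℝ, |δ| = |γ| →
      -(q / t) * (q + N - 2) + t * Phi δ (q + β) ≤ -((q ^ 2 + μ ^ 2) / 4))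
    (ha : 1 ≤ a) (hb : b ≤ 2) (hab : 32 < μ * (b - a)) (h : θ β a < level j) :
    θ β b < level (j + 1) := by
  by_contra! hcon
  have hlt : a < b := by
    by_contra! hle
    nlinarith
  set m := (a + b) / 2 with hm
  have hsec : ∀ t ∈ Icc a m, θ β t ∈ Ioo (level (j + 1)) (level j) := by
    intro t ht
    have ht0 : 0 < t := by linarith [ht.1]
    constructor
    · by_contra! h1
      exact absurd (P.lt_level ht0 h1 (by linarith [ht.2] : t < b)) (not_lt.mpr hcon)
    · rcases ht.1.eq_or_lt with rfl | h1
      · exact h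
      · exact P.lt_level (by linarith) h.le h1
  set y : ℝ → ℝ := fun t => Real.arctan (Real.tan (θ β t) / μ) + μ / 4 * t with hy
  have hd : ∀ t ∈ Icc a m, ∃ y', HasDerivAt y y' t ∧ y' ≤ 0 := by
    intro t ht
    have ht0 : 0 < t := by linarith [ht.1]
    have h1 := P.hasDerivAt_tan ht0 (hsec t ht)
    have h2 := (h1.div_const μ).arctan.add ((hasDerivAt_id t).const_mul (μ / 4))
    refine ⟨_, h2, ?_⟩
    have h3 := hβ t ⟨by linarith [ht.1], by linarith [ht.2]⟩ ((-1) ^ j * γ)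
      (Real.tan (θ β t)) (abs_neg_one_pow_mul γ j)
    generalize -(Real.tan (θ β t) / t) * (Real.tan (θ β t) + N - 2) +
      t * Phi ((-1) ^ j * γ) (Real.tan (θ β t) + β) = d at h3
    generalize Real.tan (θ β t) = q at h3
    have h4 : 1 / (1 + (q / μ) ^ 2) * (d / μ) = μ * d / (q ^ 2 + μ ^ 2) := by
      field_simp; ring
    have h5 : μ * d / (q ^ 2 + μ ^ 2) ≤ -(μ / 4) := by
      rw [div_le_iff₀ (by positivity)]
      nlinarith
    rw [h4]
    linarith
  have hanti : AntitoneOn y (Icc a m) := by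
    apply antitoneOn_of_deriv_nonpos (convex_Icc a m)
    · intro t ht
      obtain ⟨_, h1, _⟩ := hd t ht
      exact h1.continuousAt.continuousWithinAt
    · intro t ht
      obtain ⟨_, h1, _⟩ := hd t (interior_subset ht)
      exact h1.differentiableAt.differentiableWithinAt
    · intro t ht
      obtain ⟨_, h1, h2⟩ := hd t (interior_subset ht)
      rwa [h1.deriv]
  have ham : a ≤ m := by linarith
  have h1 := hanti ⟨le_rfl, ham⟩ ⟨ham, le_rfl⟩ ham
  have h2 := Real.arctan_lt_pi_div_two (Real.tan (θ β a) / μ)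
  have h3 := Real.neg_pi_div_two_lt_arctan (Real.tan (θ β m) / μ)
  have h4 := Real.pi_le_four
  simp only [hy] at h1
  have h5 : μ / 4 * m - μ / 4 * a = μ * (b - a) / 8 := by rw [hm]; ring
  linarith

lemma crossing_nonempty (P : IsPolar N γ F G θ ρ) (k : ℕ) : (crossing θ k).Nonempty := by
  -- traverse `k + 1` sectors, one in each subinterval of `[1, 2]` of length `1 / (k + 1)`
  set ℓ : ℝ := 1 / (k + 1) with hℓ
  have hk : (0 : ℝ) < k + 1 := by positivity
  have hℓ0 : 0 < ℓ := by positivity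
  obtain ⟨β, hβ⟩ := exists_riccati_le N P.abs_lt_one (33 * (k + 1))
  have key : ∀ j : ℕ, j ≤ k + 1 → θ β (1 + j * ℓ) < level j := by
    intro j
    induction j with
    | zero => intro _; simpa using P.lt_level_zero β zero_le_one
    | succ j ih =>
      intro hj
      have hj' : ((j + 1 : ℕ) : ℝ) ≤ k + 1 := by exact_mod_cast hj
      refine P.lt_level_succ_of_riccati_le (by positivity) hβ (a := 1 + j * ℓ) ?_ ?_ ?_
        (ih (by omega))
      · have : 0 ≤ (j : ℝ) * ℓ := by positivity
        linarith
      · have : ((j + 1 : ℕ) : ℝ) * ℓ ≤ 1 := by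
          rw [hℓ, mul_one_div, div_le_one hk]; exact hj'
        linarith
      · push_cast
        have : (1 + ((j : ℝ) + 1) * ℓ - (1 + j * ℓ)) = ℓ := by ring
        rw [this, hℓ, mul_one_div, mul_div_assoc, div_self hk.ne']
        norm_num
  exact ⟨β, _, by positivity, key (k + 1) le_rfl⟩

/-- The profile with exponent `0` is the constant `1`. -/
lemma angle_zero_param (P : IsPolar N γ F G θ ρ) {t : ℝ} (ht : 0 ≤ t) : θ 0 t = 0 := by
  have hsol : IsSolution N γ 0 (fun _ => 1) (fun _ => 0) :=
    ⟨continuousOn_const, continuousOn_const, rfl, rfl, fun t _ => hasDerivAt_const t 1,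
      fun t _ => by simpa using hasDerivAt_const t (0 : ℝ)⟩
  have heq := fun s (hs : 0 ≤ s) =>
    (P.isSolution 0).eq_of_nonneg P.one_le P.abs_lt_one.le hsol hs
  have hcos : ∀ s, 0 ≤ s → Real.cos (θ 0 s) ≠ 0 := by
    intro s hs h0
    have h1 := P.F_eq 0 s hs
    rw [(heq s hs).1, h0, mul_zero] at h1
    exact one_ne_zero h1
  have hsin : Real.sin (θ 0 t) = 0 := by
    have h1 := P.G_eq 0 t ht
    rw [(heq t ht).2, mul_zero, eq_comm, mul_eq_zero] at h1
    exact h1.resolve_left (P.radius_pos 0 t ht).ne'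
  have hup := P.lt_level_zero 0 ht
  have hlow : level 1 < θ 0 t := by
    by_contra! hcon
    have h1 : level 1 ∈ Icc (θ 0 t) (θ 0 0) := by
      refine ⟨hcon, ?_⟩
      rw [P.angle_zero]
      unfold level
      push_cast
      linarith [Real.pi_pos]
    obtain ⟨s, hs, hs'⟩ := intermediate_value_Icc' ht (P.continuous 0).continuousOn h1
    exact hcos s hs.1 (by rw [hs', cos_level])
  unfold level at hup hlow
  push_cast at hup hlow
  exact (Real.sin_eq_zero_iff_of_lt_of_lt (by linarith [Real.pi_pos])
    (by linarith [Real.pi_pos])).mp hsin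

lemma eventually_notMem_crossing_zero (P : IsPolar N γ F G θ ρ) :
    ∀ᶠ β in 𝓝 (0 : ℝ), β ∉ crossing θ 0 := by
  obtain ⟨R, hR, hpos⟩ := exists_angleField_floorAngle_pos N P.abs_lt_one 1
  refine P.eventually_notMem_crossing hR hpos (by simp) le_rfl ?_
  rw [P.angle_zero_param hR.le]
  unfold floorAngle
  simp only [neg_zero, zero_sub, CharP.cast_eq_zero, zero_mul, sub_zero, Real.arctan_neg]
  have : 0 < Real.arctan 2 := Real.arctan_pos.mpr two_pos
  linarith

lemma crossing_subset_Ioi (P : IsPolar N γ F G θ ρ) (k : ℕ) : crossing θ k ⊆ Ioi 0 := by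
  have h0 : crossing θ k ⊆ crossing θ 0 := by
    induction k with
    | zero => exact subset_rfl
    | succ k ih => exact (crossing_succ_subset k).trans ih
  intro α hα
  by_contra hneg
  have h2 : (0 : ℝ) ∉ crossing θ 0 := P.eventually_notMem_crossing_zero.self_of_nhds
  rcases (not_lt.mp (mem_Ioi.not.mp hneg)).eq_or_lt with h | h
  · exact h2 (h ▸ h0 hα)
  · exact h2 (P.mem_crossing_of_lt (h0 hα) h)

end IsPolar

/-! ### The similarity exponents -/

/-- The infimum of the exponents for which the profile has more than `k` zeros; these are the similarity
exponents. -/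
def threshold (θ : ℝ → ℝ → ℝ) (k : ℕ) : ℝ := sInf (crossing θ k)

namespace IsPolar

variable {N : ℕ} {γ : ℝ} {F G θ ρ : ℝ → ℝ → ℝ}

lemma bddBelow_crossing (P : IsPolar N γ F G θ ρ) (k : ℕ) : BddBelow (crossing θ k) :=
  ⟨0, fun _ h => (P.crossing_subset_Ioi k h).le⟩

lemma mem_crossing_iff (P : IsPolar N γ F G θ ρ) {k : ℕ} {α : ℝ} :
    α ∈ crossing θ k ↔ threshold θ k < α := by
  constructor
  · intro h
    have h1 : ∀ᶠ β in 𝓝[<] α, β ∈ crossing θ k :=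
      nhdsWithin_le_nhds ((P.isOpen_crossing k).mem_nhds h)
    obtain ⟨β, hβ, hβα⟩ := (h1.and self_mem_nhdsWithin).exists
    exact (csInf_le (P.bddBelow_crossing k) hβ).trans_lt hβα
  · intro h
    obtain ⟨β, hβ, hβα⟩ := exists_lt_of_csInf_lt (P.crossing_nonempty k) h
    exact P.mem_crossing_of_lt hβ hβα

lemma threshold_notMem (P : IsPolar N γ F G θ ρ) (k : ℕ) : threshold θ k ∉ crossing θ k := by
  rw [P.mem_crossing_iff]; exact lt_irrefl _

lemma lt_threshold_of_eventually (P : IsPolar N γ F G θ ρ) {k : ℕ} {α : ℝ}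
    (h : ∀ᶠ β in 𝓝 α, β ∉ crossing θ k) : α < threshold θ k := by
  have h1 : ∀ᶠ β in 𝓝[>] α, β ∉ crossing θ k := nhdsWithin_le_nhds h
  obtain ⟨β, hβ, hβα⟩ := (h1.and self_mem_nhdsWithin).exists
  rw [P.mem_crossing_iff, not_lt] at hβ
  exact lt_of_lt_of_le hβα hβ

lemma threshold_zero_pos (P : IsPolar N γ F G θ ρ) : 0 < threshold θ 0 :=
  P.lt_threshold_of_eventually P.eventually_notMem_crossing_zero

lemma threshold_strictMono (P : IsPolar N γ F G θ ρ) : StrictMono (threshold θ) := by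
  refine strictMono_nat_of_lt_succ fun k => P.lt_threshold_of_eventually ?_
  obtain ⟨R, hR, hpos⟩ := exists_angleField_floorAngle_pos N P.abs_lt_one (|threshold θ k| + 1)
  refine P.eventually_notMem_crossing hR hpos (lt_add_one _) le_rfl ?_
  exact (floorAngle_lt_level _ _).trans (P.level_lt_of_notMem (P.threshold_notMem k) hR.le)

lemma tendsto_threshold (P : IsPolar N γ F G θ ρ) : Tendsto (threshold θ) atTop atTop := by
  refine tendsto_atTop_atTop_of_monotone P.threshold_strictMono.monotone fun b => ?_
  obtain ⟨k, hk⟩ := P.exists_notMem_crossing b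
  rw [P.mem_crossing_iff, not_lt] at hk
  exact ⟨k, hk⟩

lemma inSector_threshold (P : IsPolar N γ F G θ ρ) (k : ℕ) : InSector θ (threshold θ k) k :=
  P.inSector (P.threshold_notMem k) fun j hj => by
    rw [P.mem_crossing_iff]
    exact P.threshold_strictMono (by omega)

/-- At the thresholds the decay is fast, since slow decay would persist at larger exponents. -/
theorem asympTo_threshold (P : IsPolar N γ F G θ ρ) (k : ℕ) :
    AsympTo (F (threshold θ k)) fun t => t ^ (threshold θ k - (N : ℝ)) *
      Real.exp (-((1 + (-1) ^ k * γ) / 4) * t ^ 2) := by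
  have hs := P.inSector_threshold k
  refine P.asympTo_fast hs ?_
  obtain ⟨R, hR, hpos⟩ := exists_angleField_floorAngle_pos N P.abs_lt_one (|threshold θ k| + 1)
  filter_upwards [hs, eventually_ge_atTop R] with t ht htR
  rw [← le_floorAngle_iff ht]
  by_contra! hcon
  exact lt_irrefl _ (P.lt_threshold_of_eventually
    (P.eventually_notMem_crossing hR hpos (lt_add_one _) htR hcon))

/-- An exponent with fast decay is a threshold by `mem_crossing_of_fast`. -/
theorem asympTo_of_notMem_range (P : IsPolar N γ F G θ ρ) {α : ℝ}
    (hα : α ∉ range (threshold θ)) : AsympTo (F α) fun t => t ^ (-α) := by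
  classical
  have hex := P.exists_notMem_crossing α
  set k := Nat.find hex with hk
  have hkα : α ∉ crossing θ k := Nat.find_spec hex
  have hs : InSector θ α k := P.inSector hkα fun j hj =>
    not_not.mp (Nat.find_min hex (by omega : j < k))
  obtain ⟨R, hR, hpos⟩ := exists_angleField_floorAngle_pos N P.abs_lt_one |α|
  by_cases hslow : ∃ s, R ≤ s ∧ floorAngle α k < θ α s
  · obtain ⟨s, hsR, hf⟩ := hslow
    exact P.asympTo_slow hs hR (fun t ht => hpos α le_rfl t ht k) hsR hf
  · exfalso
    push Not at hslow
    have hf : ∀ᶠ t in atTop, Real.tan (θ α t) ≤ -α - 2 := by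
      filter_upwards [hs, eventually_ge_atTop R] with t ht htR
      exact (le_floorAngle_iff ht).mp (hslow t htR)
    apply hα
    refine ⟨k, le_antisymm ?_ ?_⟩
    · refine le_of_forall_gt_imp_ge_of_dense fun β hβ => ?_
      exact (P.mem_crossing_iff.mp (P.mem_crossing_of_fast hs hf hβ)).le
    · rwa [P.mem_crossing_iff, not_lt] at hkα

lemma exists_eq_level (P : IsPolar N γ F G θ ρ) {α t : ℝ} (ht : 0 ≤ t) (h : F α t = 0) :
    ∃ j, 1 ≤ j ∧ θ α t = level j := by
  rw [P.F_eq α t ht] at h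
  have hcos := (mul_eq_zero.mp h).resolve_left (P.radius_pos α t ht).ne'
  obtain ⟨i, hi⟩ := Real.cos_eq_zero_iff.mp hcos
  have h1 := P.lt_level_zero α ht
  have h2 : i < 0 := by
    by_contra! hi0
    have : (0 : ℝ) ≤ i := by exact_mod_cast hi0
    unfold level at h1
    rw [hi] at h1
    push_cast at h1
    nlinarith [Real.pi_pos]
  refine ⟨i.natAbs, by omega, ?_⟩
  rw [hi]
  unfold level
  have : ((i.natAbs : ℕ) : ℝ) = -(i : ℝ) := by
    rw [← Int.cast_natCast, show ((i.natAbs : ℕ) : ℤ) = -i by omega, Int.cast_neg]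
  rw [this]
  ring

/-- The angle maps the zeros of the profile bijectively onto the levels number `1, ..., k + 1`. -/
theorem encard_zeros (P : IsPolar N γ F G θ ρ) {α : ℝ} {k : ℕ} (h : α ∈ crossing θ k)
    (h' : α ∉ crossing θ (k + 1)) :
    {t : ℝ | 0 ≤ t ∧ F α t = 0}.encard = ((k + 1 : ℕ) : ℕ∞) := by
  have hzero : ∀ t, 0 ≤ t → ∀ j, θ α t = level j → F α t = 0 := by
    intro t ht j hj
    rw [P.F_eq α t ht, hj, cos_level, mul_zero]
  have hpos : ∀ t, 0 ≤ t → F α t = 0 → 0 < t := by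
    intro t ht h0
    rcases ht.eq_or_lt with rfl | ht
    · rw [(P.isSolution α).f_zero] at h0; exact absurd h0 one_ne_zero
    · exact ht
  have hinj : InjOn (θ α) {t : ℝ | 0 ≤ t ∧ F α t = 0} := by
    have key : ∀ s t, 0 ≤ s → F α s = 0 → s < t → θ α s ≠ θ α t := by
      intro s t hs h0 hst heq
      obtain ⟨j, _, hj⟩ := P.exists_eq_level hs h0
      have := P.lt_level (hpos s hs h0) hj.le hst
      rw [← heq, hj] at this
      exact lt_irrefl _ this
    intro s hs t ht heq
    rcases lt_trichotomy s t with hst | hst | hst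
    · exact absurd heq (key s t hs.1 hs.2 hst)
    · exact hst
    · exact absurd heq.symm (key t s ht.1 ht.2 hst)
  have himg : θ α '' {t : ℝ | 0 ≤ t ∧ F α t = 0} = level '' (Finset.Icc 1 (k + 1) : Finset ℕ) := by
    ext x
    constructor
    · rintro ⟨t, ⟨ht, h0⟩, rfl⟩
      obtain ⟨j, hj1, hj⟩ := P.exists_eq_level ht h0
      refine ⟨j, ?_, hj.symm⟩
      have h2 := P.level_lt_of_notMem h' ht
      rw [hj, level_strictAnti.lt_iff_gt] at h2
      rw [Finset.coe_Icc]
      exact ⟨hj1, by omega⟩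
    · rintro ⟨j, hj, rfl⟩
      rw [Finset.coe_Icc] at hj
      obtain ⟨t, ht, hlt⟩ := h
      have h1 : level j ∈ Icc (θ α t) (θ α 0) := by
        refine ⟨hlt.le.trans (level_strictAnti.antitone hj.2), ?_⟩
        rw [P.angle_zero]
        refine (level_strictAnti.antitone hj.1).trans ?_
        unfold level
        push_cast
        linarith [Real.pi_pos]
      obtain ⟨s, hs, hs'⟩ := intermediate_value_Icc' ht.le (P.continuous α).continuousOn h1
      exact ⟨s, ⟨hs.1, hzero s hs.1 j hs'⟩, hs'⟩
  rw [← hinj.encard_image, himg, level_strictAnti.injective.encard_image,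
    Set.encard_coe_eq_coe_finsetCard, Nat.card_Icc]
  simp

theorem F_pos (P : IsPolar N γ F G θ ρ) {α : ℝ} (h : α ∉ crossing θ 0) {t : ℝ} (ht : 0 ≤ t) :
    0 < F α t := by
  have := P.pos_of_mem_sector (k := 0) ht ⟨P.level_lt_of_notMem h ht, P.lt_level_zero α ht⟩
  simpa using this

end IsPolar

lemma AsympTo.congr {f g φ : ℝ → ℝ} (h : AsympTo f φ) (hfg : EqOn g f (Ici 0)) :
    AsympTo g φ := by
  obtain ⟨C, hC, hlim⟩ := h
  refine ⟨C, hC, hlim.congr' ?_⟩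
  filter_upwards [eventually_ge_atTop 0] with t ht
  rw [hfg ht]

lemma not_asympTo_gaussian_and_power {f : ℝ → ℝ} {a r s : ℝ} (hs : 0 < s)
    (h₁ : AsympTo f fun t => t ^ r * Real.exp (-s * t ^ 2)) : ¬ AsympTo f fun t => t ^ a := by
  rintro ⟨C, hC, hC'⟩
  obtain ⟨D, _, hD⟩ := h₁
  have h1 : Tendsto (fun t : ℝ => t ^ (r - a) * Real.exp (-s * t ^ 2)) atTop (𝓝 0) := by
    refine squeeze_zero' ?_ ?_ (tendsto_rpow_mul_exp_neg_mul_atTop_nhds_zero (r - a) s hs)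
    · filter_upwards [eventually_gt_atTop 0] with t ht
      positivity
    · filter_upwards [eventually_ge_atTop 1] with t ht
      have : -s * t ^ 2 ≤ -s * t := by
        nlinarith [mul_nonneg hs.le (mul_nonneg (zero_le_one.trans ht) (sub_nonneg.mpr ht))]
      have h0 : 0 ≤ t ^ (r - a) := Real.rpow_nonneg (by linarith) _
      exact mul_le_mul_of_nonneg_left (Real.exp_le_exp.mpr this) h0
  have h2 := hD.mul h1
  rw [mul_zero] at h2
  refine hC (tendsto_nhds_unique hC' (h2.congr' ?_))
  filter_upwards [eventually_gt_atTop 0] with t ht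
  rw [Real.rpow_sub ht]
  have : 0 < t ^ r := Real.rpow_pos_of_pos ht r
  have : 0 < t ^ a := Real.rpow_pos_of_pos ht a
  field_simp

/-- The two decay laws exclude each other, so that a sequence of similarity exponents is determined by its
range. -/
lemma IsExponentSeq.range_subset {N : ℕ} {γ : ℝ} (hγ : |γ| < 1) {a b : ℕ → ℝ}
    (ha : IsExponentSeq N γ a) (hb : IsExponentSeq N γ b)
    (hex : ∀ α, 0 < α → ∃ f, IsProfile N γ α f) : range a ⊆ range b := by
  rintro _ ⟨k, rfl⟩
  by_contra hcon
  have hpos : 0 < a k := ha.1.trans_le (ha.2.1.monotone (Nat.zero_le k))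
  obtain ⟨f, hf⟩ := hex _ hpos
  have hs : 0 < (1 + (-1) ^ k * γ) / 4 := by
    have := neg_abs_le ((-1) ^ k * γ)
    rw [abs_neg_one_pow_mul] at this
    linarith
  exact not_asympTo_gaussian_and_power hs (ha.2.2.2.1 k f hf) (hb.2.2.2.2 _ hpos hcon f hf)

lemma exists_isProfile {N : ℕ} (hN : 1 ≤ N) {γ : ℝ} (hγ : |γ| ≤ 1) (α : ℝ) :
    ∃ f, IsProfile N γ α f := by
  obtain ⟨f, g, h, hd, hg⟩ := exists_isSolution hN hγ α
  refine ⟨f, g, fun t _ => (hd t).hasDerivWithinAt, hg.continuousOn, h.f_zero, h.g_zero,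
    fun t ht => ?_⟩
  simpa only [sigma_mul_self] using h.hasDerivAt_g t ht

lemma IsPolar.eqOn_of_isProfile {N : ℕ} {γ : ℝ} {F G θ ρ : ℝ → ℝ → ℝ}
    (P : IsPolar N γ F G θ ρ) {α : ℝ} {f : ℝ → ℝ} (hf : IsProfile N γ α f) :
    EqOn f (F α) (Ici 0) := by
  obtain ⟨g, hg⟩ := hf.exists_isSolution
  exact fun t ht => (hg.eq_of_nonneg P.one_le P.abs_lt_one.le (P.isSolution α) ht).1

lemma IsPolar.isExponentSeq_threshold {N : ℕ} {γ : ℝ} {F G θ ρ : ℝ → ℝ → ℝ}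
    (P : IsPolar N γ F G θ ρ) : IsExponentSeq N γ (threshold θ) :=
  ⟨P.threshold_zero_pos, P.threshold_strictMono, P.tendsto_threshold,
    fun k _ hf => (P.asympTo_threshold k).congr (P.eqOn_of_isProfile hf),
    fun _ _ hα _ hf => (P.asympTo_of_notMem_range hα).congr (P.eqOn_of_isProfile hf)⟩

end Barenblatt

end

theorem theorem2 (N : ℕ) (hN : 1 ≤ N) (γ : ℝ) (hγ₁ : -1 < γ) (hγ₂ : γ < 1) :
    -- existence and uniqueness of the profile, for every positive exponent
    (∀ α : ℝ, 0 < α → ∃ f : ℝ → ℝ, Barenblatt.IsProfile N γ α f ∧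
      ∀ g : ℝ → ℝ, Barenblatt.IsProfile N γ α g → Set.EqOn g f (Set.Ici 0)) ∧
    -- the sequence of similarity exponents exists
    (∃ a : ℕ → ℝ, Barenblatt.IsExponentSeq N γ a) ∧
    -- the number of zeros of the profiles
    ∀ a : ℕ → ℝ, Barenblatt.IsExponentSeq N γ a →
      (∀ (k : ℕ) (α : ℝ), a k < α → α ≤ a (k + 1) →
        ∀ f : ℝ → ℝ, Barenblatt.IsProfile N γ α f →
          {η : ℝ | 0 ≤ η ∧ f η = 0}.encard = ((k + 1 : ℕ) : ℕ∞)) ∧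
      (∀ α : ℝ, 0 < α → α ≤ a 0 →
        ∀ f : ℝ → ℝ, Barenblatt.IsProfile N γ α f → ∀ η : ℝ, 0 ≤ η → 0 < f η) := by
  have hγ : |γ| < 1 := abs_lt.mpr ⟨hγ₁, hγ₂⟩
  obtain ⟨F, G, θ, ρ, P⟩ := Barenblatt.exists_isPolar hN hγ
  have hex : ∀ α, 0 < α → ∃ f, Barenblatt.IsProfile N γ α f := fun α _ =>
    Barenblatt.exists_isProfile hN hγ.le α
  refine ⟨fun α hα => ?_, ⟨_, P.isExponentSeq_threshold⟩, fun a ha => ?_⟩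
  · obtain ⟨f, hf⟩ := hex α hα
    exact ⟨f, hf, fun g hg =>
      (P.eqOn_of_isProfile hg).trans (P.eqOn_of_isProfile hf).symm⟩
  have hb := P.isExponentSeq_threshold
  obtain rfl : a = Barenblatt.threshold θ := (ha.2.1.range_inj hb.2.1).mp
    ((ha.range_subset hγ hb hex).antisymm (hb.range_subset hγ ha hex))
  refine ⟨fun k α h₁ h₂ f hf => ?_, fun α _ hα f hf η hη => ?_⟩
  · have heq : {η : ℝ | 0 ≤ η ∧ f η = 0} = {η : ℝ | 0 ≤ η ∧ F α η = 0} := by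
      ext η
      exact and_congr_right fun hη => by rw [P.eqOn_of_isProfile hf hη]
    rw [heq]
    exact P.encard_zeros (P.mem_crossing_iff.mpr h₁)
      (by rw [P.mem_crossing_iff]; exact not_lt.mpr h₂)
  · rw [P.eqOn_of_isProfile hf hη]
    exact P.F_pos (by rw [P.mem_crossing_iff]; exact not_lt.mpr hα) hη
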